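/- **Definitions.** A polyhedral terrain over the unit square $D=[0,1]^2$ is a finite triangulation of $D$ with a height function that is affine on each triangle. The geodesic distance of two points of $D$ is the length of a shortest path on the surface between the points above them. For sites $p_1,\dots,p_m\in D$, the Voronoi cell of $p_i$ is the set of points whose geodesic distance to $p_i$ is at most that to every other site. A Voronoi vertex is a point in at least three cells; the Voronoi edges consist of the points in exactly two cells. A breakpoint is a point of a Voronoi edge from which the shortest path to one of its two nearest sites is not unique; the breakpoints cut the Voronoi edges into chords. The complexity of the geodesic Voronoi diagram is the number of Voronoi vertices, plus the number of breakpoints, plus the number of points at which chords meet the edges of the triangulation. **Farming terrain.** Let $c>0$, let $n,m,k\ge 1$ be integers, put $s=1/(c\sqrt m)$, and let $\omega\ge 0$, $\varepsilon>0$, $h>0$. A farming terrain with these parameters is a polyhedral terrain over $D$ as follows. (a) There are $k$ farms, squares of side $s$ touching the west wall $x=0$, the $i$-th one ($0\le i<k$) occupying $[0,s]\times[y_i,y_i+s]$ with $y_i=1-(3i+2)s$ (so adjacent farms are $2s$ apart). (b) Along the east wall there are $2n$ equally wide rectangles (a sequence of $n$ ridges), each extending from the south to the north wall, together occupying $[w,1]\times[0,1]$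 with $w=1-\frac{1}{\sqrt2\,c\,2^n}$; on them the height rises from west to east with slope $45^\circ$ from $h$ on the 1st, 3rd, … rectangle, and falls with slope $45^\circ$ back to $h$ on the 2nd, 4th, … (so the geodesic distance across all ridges is $1/(c2^n)$). (c) From the south-east corner of each farm a road $[s,w]\times[y_i,y_i+\omega]$ leads to the first ridge. (d) The height is $h$ on farms and roads, it is $0$ at every point of $D$ whose distance from all farms, roads and ridges is at least $\varepsilon$, and it is between $0$ and $h$ everywhere else off the ridges. **Lemma.** Let $c,\kappa>0$. There are constants $A$, $K>0$ and $m_0$, depending only on $c$ and $\kappa$, such that for every $C$ there is $n_0$ with the following property. Let $n\ge n_0$ and $m\ge m_0$ with $m\le Cn$. Then there are $\eta>0$ and $h_0$ such that for all integers $k$ with $\kappa\sqrt m\le k\le c\sqrt m/3$, all $\omega\in[0,\eta)$, all $\varepsilon\in(0,\eta)$ and all $h\ge h_0$: (1) there is a farming terrain with these parameters whose triangulation has at most $A\,n$ vertices; and (2) on every farming terrain with these parameters, the geodesic Voronoi diagram of $m$ independent uniformly random sites in $D$ has expected complexity at least $K\,n\sqrt m$. -/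

import Mathlib

open scoped ENNReal

noncomputable section

namespace Farming

/-- The `(x, y)`-plane with its Euclidean norm; `p 0` is the `x`- and `p 1` the `y`-coordinate. -/
abbrev Plane : Type := EuclideanSpace ℝ (Fin 2)

/-- The domain of all terrains. Its west, east, south and north walls are
`x = 0`, `x = 1`, `y = 0` and `y = 1`. -/
def unitSquare : Set Plane := {p | ∀ i, p i ∈ Set.Icc (0 : ℝ) 1}

/-- A polyhedral terrain over the unit square: a finite triangulation of the square, and
a height function which is affine on every simplex of the triangulation (so that, on the square,
it is the linear interpolation of its values at the vertices). -/
structure Terrain where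
  triangulation : Geometry.SimplicialComplex ℝ Plane
  finite_faces : triangulation.faces.Finite
  space_eq : triangulation.space = unitSquare
  height : Plane → ℝ
  affine_on_faces : ∀ s ∈ triangulation.faces, ∃ A : Plane →ᵃ[ℝ] ℝ,
    Set.EqOn height A (convexHull ℝ (s : Set Plane))

namespace Terrain

variable (T : Terrain)

/-- The point of the surface above a point of the plane. -/
def lift (p : Plane) : EuclideanSpace ℝ (Fin 3) := !₂[p 0, p 1, T.height p]

/-- The length of the curve on the surface of the terrain that lies above a path in the square. -/
def pathLength {p q : unitSquare} (γ : Path p q) : ℝ≥0∞ :=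
  eVariationOn (fun t => T.lift (γ t)) Set.univ

/-- The geodesic distance: the least length of a path on the surface. (Paths on the surface
are the lifts of the paths in the square.) -/
def geoDist (p q : unitSquare) : ℝ≥0∞ := ⨅ γ : Path p q, T.pathLength γ

/-- All shortest paths between the two points coincide as curves on the surface
(that is, up to parametrization). -/
def UniqueShortestPath (p q : unitSquare) : Prop :=
  ∀ γ γ' : Path p q, T.pathLength γ = T.geoDist p q → T.pathLength γ' = T.geoDist p q →
    Set.range γ = Set.range γ'

/-- The union of the vertices and edges of the triangulation. -/
def skeleton : Set unitSquare :=
  {z | ∃ s ∈ T.triangulation.faces, s.card ≤ 2 ∧ (z : Plane) ∈ convexHull ℝ (s : Set Plane)}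

variable {m : ℕ} (P : Fin m → unitSquare)

/-- The geodesic Voronoi cell of the site `P i`. -/
def cell (i : Fin m) : Set unitSquare := {z | ∀ j, T.geoDist z (P i) ≤ T.geoDist z (P j)}

/-- The sites whose Voronoi cells contain `z`. -/
def incident (z : unitSquare) : Set (Fin m) := {i | z ∈ T.cell P i}

/-- The points that are incident to at least three cells. -/
def voronoiVertices : Set unitSquare := {z | 3 ≤ (T.incident P z).encard}

/-- The union of all Voronoi edges: the points of bisectors incident to exactly two cells. -/
def voronoiEdgePoints : Set unitSquare := {z | (T.incident P z).encard = 2}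

/-- The points of Voronoi edges at which the shortest path to one of the two sites
is not unique. -/
def breakpoints : Set unitSquare :=
  {z | z ∈ T.voronoiEdgePoints P ∧ ∃ i ∈ T.incident P z, ¬ T.UniqueShortestPath z (P i)}

/-- The union of all chords: the breakpoints cut the Voronoi edges into the chords. -/
def chordPoints : Set unitSquare := T.voronoiEdgePoints P \ T.breakpoints P

/-- The combinatorial complexity of the geodesic Voronoi diagram: the number of Voronoi vertices,
plus the number of breakpoints of Voronoi edges, plus the number of intersections of chords
with the triangulation. -/
def voronoiComplexity : ℕ∞ :=
  (T.voronoiVertices P).encard + (T.breakpoints P).encard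
    + (T.chordPoints P ∩ T.skeleton).encard

end Terrain

/-- The uniform distribution on the unit square. -/
def uniformSquare : MeasureTheory.Measure unitSquare :=
  MeasureTheory.Measure.comap Subtype.val MeasureTheory.volume

/-- The law of `m` independent uniform random points of the unit square. -/
def siteLaw (m : ℕ) : MeasureTheory.Measure (Fin m → unitSquare) :=
  MeasureTheory.Measure.pi fun _ => uniformSquare

/-- The expected complexity of the geodesic Voronoi diagram of `m` independent uniform
random sites. -/
def expectedComplexity (T : Terrain) (m : ℕ) : ℝ≥0∞ :=
  ∫⁻ P, (T.voronoiComplexity P : ℝ≥0∞) ∂(siteLaw m)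

/-- The side length of a farm. -/
def farmSide (c : ℝ) (m : ℕ) : ℝ := 1 / (c * √(m : ℝ))

/-- The `y`-coordinate of the southern side of the `i`-th farm, counted from the north;
consecutive farms are `2 / (c √m)` apart. -/
def farmSouth (c : ℝ) (m i : ℕ) : ℝ := 1 - (3 * i + 2) * farmSide c m

/-- The `i`-th farm, a square that touches the west wall. -/
def farm (c : ℝ) (m i : ℕ) : Set Plane :=
  {p | p 0 ∈ Set.Icc 0 (farmSide c m) ∧
    p 1 ∈ Set.Icc (farmSouth c m i) (farmSouth c m i + farmSide c m)}

/-- The width, in the projection, of the sequence of ridges. All the rectangles have slope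
`± 45°`, so the geodesic distance across the sequence is `√2` times this, which is
`1 / (c 2 ^ n)`. -/
def ridgesWidth (c : ℝ) (n : ℕ) : ℝ := 1 / (√2 * (c * 2 ^ n))

/-- The `x`-coordinate of the west edge of the first ridge. -/
def ridgesWest (c : ℝ) (n : ℕ) : ℝ := 1 - ridgesWidth c n

/-- The `x`-coordinate of the west edge of the `j`-th rectangle (`j = 0, …, 2n - 1`) of the
sequence of ridges. -/
def ridgeLine (c : ℝ) (n j : ℕ) : ℝ := ridgesWest c n + j * (ridgesWidth c n / (2 * n))

/-- The part of the square that is covered by the ridges, from the north to the south wall. -/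
def ridges (c : ℝ) (n : ℕ) : Set Plane := {p | p ∈ unitSquare ∧ ridgesWest c n ≤ p 0}

/-- The road, of width `ω`, from the south-east corner of the `i`-th farm
due east to the first ridge. -/
def road (c : ℝ) (n m : ℕ) (ω : ℝ) (i : ℕ) : Set Plane :=
  {p | p 0 ∈ Set.Icc (farmSide c m) (ridgesWest c n) ∧
    p 1 ∈ Set.Icc (farmSouth c m i) (farmSouth c m i + ω)}

/-- Everything that is built: `k` farms with their roads, and the ridges. -/
def builtArea (c : ℝ) (n m k : ℕ) (ω : ℝ) : Set Plane :=
  (⋃ i < k, farm c m i ∪ road c n m ω i) ∪ ridges c n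

/-- `T` is a farming terrain with `k` farms (sized for `m` sites), a sequence of ridges of
length `n`, roads of width `ω`, steep boundary regions of width `ε` and height `h`. -/
structure IsFarmingTerrain (T : Terrain) (c : ℝ) (n m k : ℕ) (ω ε h : ℝ) : Prop where
  /-- Farms and roads are flat, at height `h`. -/
  height_farm_road : ∀ i < k, ∀ p ∈ farm c m i ∪ road c n m ω i, T.height p = h
  /-- The first, third, … rectangle of the ridges rises from `h` to the east at `45°`. -/
  height_ridge_up : ∀ j < 2 * n, Even j → ∀ p ∈ unitSquare,
    p 0 ∈ Set.Icc (ridgeLine c n j) (ridgeLine c n (j + 1)) →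
      T.height p = h + (p 0 - ridgeLine c n j)
  /-- The second, fourth, … rectangle of the ridges descends to `h` to the east at `45°`. -/
  height_ridge_down : ∀ j < 2 * n, Odd j → ∀ p ∈ unitSquare,
    p 0 ∈ Set.Icc (ridgeLine c n j) (ridgeLine c n (j + 1)) →
      T.height p = h + (ridgeLine c n (j + 1) - p 0)
  /-- The forbidden area has height `0`, except within distance `ε` of what is built. -/
  height_forbidden : ∀ p ∈ unitSquare, (∀ q ∈ builtArea c n m k ω, ε ≤ dist p q) →
    T.height p = 0
  /-- In the boundary regions the height is between `0` and `h`. -/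
  height_boundary : ∀ p ∈ unitSquare, p ∉ builtArea c n m k ω → T.height p ∈ Set.Icc 0 h

end Farming

end

/-! Why many crossings occur. Write `s` for the side of a farm, `W` for the width of the ridges and
`w = 1 - W`, and suppose that every site lies on a farm or at height 0. Consider a farm `i` that
contains a site, and the point `z` of some ridge line at the latitude `y_i` of its road. Going
straight to the road and along it, a site of farm `i` is reached within `2W + w + s`. Any other site
is farther. A path that touches height 0 has length at least `h`. A path that avoids height 0 stays
within `ε` of the built area, so it can reach another farm `l` only along the road of `l`; it first
changes latitude by about `3s` and then still runs west across almost `w - s`, in total at least `w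
+ 2s - 3ε - ω`. Hence near `z` only sites of farm `i` compete (`mem_farm_of_mem_cell`).

On each ridge line, between the latitudes of two consecutive occupied farms, the nearest site
changes from one group of farms to another; the cells are closed there and a segment is connected,
so some point lies in two cells (`exists_two_le_incident`). The height has a kink along each of the
`2n - 1` inner ridge lines, so they belong to the skeleton and every such point counts
(`encard_le_voronoiComplexity`). This gives complexity at least `(2n - 1)(N - 1)` with `N` occupied
farms (`mul_card_occupied_le`).

Why many farms are occupied. A farm has area `1/(c² m)`, so it misses all `m` sites with probability
at most `exp(-1/c²)`, a constant less than 1. The sites that are neither on a farm nor at height 0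
lie in strips of total area `O(W + kε + kω + ε)`. As `W` is exponentially small in `n` while `m ≤
Cn`, and `η` may depend on `n` and `m`, all sites avoid the strips up to a small constant
probability. Each of the `k ≥ κ√m` farms thus contributes a fixed probability (`le_siteLaw_inter`),
and expectations are added.

Existence (`exists_isFarmingTerrain`). A grid with `O(k)` vertices covers the part west of the
ridges, a fan on the first rectangle discards the grid levels, and each further rectangle needs two
triangles; heights are interpolated from the vertices. -/

noncomputable section

namespace Farming

/-! ### Simplicial complexes from separated simplices, and linear interpolation. -/

section Complexes

open scoped Classical

variable {E : Type*} [AddCommGroup E] [Module ℝ E]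

theorem affineMap_sum_smul (ℓ : E →ᵃ[ℝ] ℝ) (s : Finset E) (w : E → ℝ) (hw : ∑ v ∈ s, w v = 1) :
    ℓ (∑ v ∈ s, w v • v) = ∑ v ∈ s, w v * ℓ v := by
  have h : ∀ x, ℓ x = ℓ.linear x + ℓ 0 := fun x => congrFun ℓ.decomp x
  have h' : ∑ v ∈ s, w v * ℓ v = ∑ v ∈ s, (w v * ℓ.linear v + w v * ℓ 0) :=
    Finset.sum_congr rfl fun v _ => by rw [← mul_add, ← h]
  rw [h', Finset.sum_add_distrib, ← Finset.sum_mul, hw, one_mul, h, map_sum]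
  simp

/-- Affine maps that agree on a set agree on its convex hull. -/
theorem eqOn_convexHull_of_eqOn (A B : E →ᵃ[ℝ] ℝ) {s : Set E} (h : Set.EqOn A B s) :
    Set.EqOn A B (convexHull ℝ s) := by
  have hc : Convex ℝ {x | A x = B x} := by
    intro x hx y hy a b _ _ hab
    have hA := Convex.combo_affine_apply (f := A) (x := x) (y := y) hab
    have hB := Convex.combo_affine_apply (f := B) (x := x) (y := y) hab
    simp only [Set.mem_ofPred_eq] at hx hy ⊢
    rw [hA, hB, hx, hy]
  exact fun x hx => convexHull_min (fun v hv => h hv) hc hx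

/-- An affine function maps the convex hull of a set into every convex set that contains its
values on the set. -/
theorem affineMap_mem_of_mem_convexHull (A : E →ᵃ[ℝ] ℝ) {s : Set E} {I : Set ℝ} (hI : Convex ℝ I)
    (h : ∀ v ∈ s, A v ∈ I) {x : E} (hx : x ∈ convexHull ℝ s) : A x ∈ I :=
  convexHull_min (t := A ⁻¹' I) (fun v hv => h v hv) (hI.affine_preimage A) hx

/-- Two simplices (given by their vertices) meet in the simplex of their common vertices. -/
def Conformal (s t : Finset E) : Prop :=
  convexHull ℝ (s : Set E) ∩ convexHull ℝ (t : Set E) ⊆ convexHull ℝ (s ∩ t : Set E)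

theorem Conformal.symm {s t : Finset E} (h : Conformal s t) : Conformal t s := by
  unfold Conformal at *
  rwa [Set.inter_comm, Set.inter_comm (t : Set E)]

theorem conformal_of_affineIndependent {s t e : Finset E}
    (he : AffineIndependent ℝ ((↑) : e → E)) (hs : s ⊆ e) (ht : t ⊆ e) : Conformal s t :=
  (he.convexHull_inter hs ht).ge

/-- A convex combination of nonpositive values is nonnegative only if all its weight sits where the
value is zero. -/
theorem mem_convexHull_filter_of_nonneg {s : Finset E} {ℓ : E →ᵃ[ℝ] ℝ} (hs : ∀ v ∈ s, ℓ v ≤ 0)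
    {x : E} (hx : x ∈ convexHull ℝ (s : Set E)) (h : 0 ≤ ℓ x) :
    x ∈ convexHull ℝ ((s.filter fun v => ℓ v = 0 : Finset E) : Set E) := by
  obtain ⟨w, hw, hw1, rfl⟩ := Finset.mem_convexHull'.1 hx
  rw [affineMap_sum_smul ℓ s w hw1] at h
  have h0 : ∀ v ∈ s, w v * ℓ v = 0 := by
    have hle : ∀ v ∈ s, w v * ℓ v ≤ 0 := fun v hv =>
      mul_nonpos_of_nonneg_of_nonpos (hw v hv) (hs v hv)
    exact (Finset.sum_eq_zero_iff_of_nonpos hle).1 (le_antisymm (Finset.sum_nonpos hle) h)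
  have hv0 : ∀ v ∈ s, ¬ ℓ v = 0 → w v = 0 := fun v hv hne =>
    (mul_eq_zero.1 (h0 v hv)).resolve_right hne
  refine Finset.mem_convexHull'.2 ⟨w, fun v hv => hw v (Finset.mem_filter.1 hv).1, ?_, ?_⟩
  · rw [← hw1, Finset.sum_filter]
    refine Finset.sum_congr rfl fun v hv => ?_
    split_ifs with h
    · rfl
    · exact (hv0 v hv h).symm
  · rw [Finset.sum_filter]
    refine Finset.sum_congr rfl fun v hv => ?_
    split_ifs with h
    · rfl
    · rw [hv0 v hv h, zero_smul]

/-- Simplices on different sides of a hyperplane meet properly if their faces in the hyperplane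
do. -/
theorem conformal_of_separated {s t : Finset E} (ℓ : E →ᵃ[ℝ] ℝ) (hs : ∀ v ∈ s, ℓ v ≤ 0)
    (ht : ∀ v ∈ t, 0 ≤ ℓ v)
    (h : Conformal (s.filter fun v => ℓ v = 0) (t.filter fun v => ℓ v = 0)) :
    Conformal s t := by
  rintro x ⟨hxs, hxt⟩
  have h1 : ℓ x ≤ 0 := affineMap_mem_of_mem_convexHull ℓ (convex_Iic 0) hs hxs
  have h2 : 0 ≤ ℓ x := affineMap_mem_of_mem_convexHull ℓ (convex_Ici 0) ht hxt
  have h3 := mem_convexHull_filter_of_nonneg hs hxs h2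
  have h4 := mem_convexHull_filter_of_nonneg (ℓ := -ℓ) (s := t) (x := x)
    (fun v hv => by simpa using ht v hv) hxt (by simpa using h1)
  have h5 : (t.filter fun v => (-ℓ) v = 0) = t.filter fun v => ℓ v = 0 := by
    ext v; simp
  rw [h5] at h4
  refine convexHull_mono ?_ (h ⟨h3, h4⟩)
  intro v hv
  simp only [Finset.coe_filter, Set.mem_inter_iff, Set.mem_ofPred_eq] at hv
  exact ⟨hv.1.1, hv.2.1⟩

/-- A common point lies in the hull of `s ∩ t`. Within the independent set `s`, hulls of faces
intersect in the hull of the common vertices, which puts it in the hull of `s' ∩ (s ∩ t)`; likewise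
for `t'`. Both sets are again faces of `s`. Thus only maximal simplices need to be compared. -/
theorem Conformal.subset {s t s' t' : Finset E} (h : Conformal s t)
    (his : AffineIndependent ℝ ((↑) : s → E)) (hit : AffineIndependent ℝ ((↑) : t → E))
    (hs : s' ⊆ s) (ht : t' ⊆ t) : Conformal s' t' := by
  rintro x ⟨hx, hx'⟩
  have h1 : x ∈ convexHull ℝ (s ∩ t : Set E) :=
    h ⟨convexHull_mono (by exact_mod_cast hs) hx, convexHull_mono (by exact_mod_cast ht) hx'⟩
  rw [← Finset.coe_inter] at h1
  have h2 := (his.convexHull_inter hs Finset.inter_subset_left).ge ⟨hx, h1⟩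
  have h3 := (hit.convexHull_inter ht Finset.inter_subset_right).ge ⟨hx', h1⟩
  rw [← Finset.coe_inter] at h2 h3
  have h4 := (his.convexHull_inter (t₁ := s' ∩ (s ∩ t)) (t₂ := t' ∩ (s ∩ t))
    (fun v hv => hs (Finset.mem_inter.1 hv).1)
    (fun v hv => (Finset.mem_inter.1 (Finset.mem_inter.1 hv).2).1)).ge ⟨h2, h3⟩
  refine convexHull_mono ?_ h4
  intro v hv
  simp only [Finset.coe_inter, Set.mem_inter_iff] at hv
  exact ⟨hv.1.1, hv.2.1⟩

/-- The simplicial complex generated by a family of pairwise conformal simplices. -/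
def complexOfFamily (F : Set (Finset E)) (hi : ∀ t ∈ F, AffineIndependent ℝ ((↑) : t → E))
    (hF : ∀ s ∈ F, ∀ t ∈ F, Conformal s t) : Geometry.SimplicialComplex ℝ E where
  faces := {s | s.Nonempty ∧ ∃ t ∈ F, s ⊆ t}
  isRelLowerSet_faces := by
    rintro s ⟨hs, t, ht, hst⟩
    exact ⟨hs, fun u hus hu => ⟨hu, t, ht, hus.trans hst⟩⟩
  indep := by
    rintro s ⟨-, t, ht, hst⟩
    exact (hi t ht).mono (s := (s : Set E)) (t := (t : Set E)) (by exact_mod_cast hst)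
  inter_subset_convexHull := by
    rintro s s' ⟨-, t, ht, hst⟩ ⟨-, t', ht', hst'⟩
    exact (hF t ht t' ht').subset (hi t ht) (hi t' ht') hst hst'

/-- Values at the vertices of a simplex extend to an affine function. -/
theorem exists_affineMap_eqOn [FiniteDimensional ℝ E] {s : Finset E}
    (hs : AffineIndependent ℝ ((↑) : s → E)) (f : E → ℝ) :
    ∃ A : E →ᵃ[ℝ] ℝ, ∀ v ∈ s, A v = f v := by
  obtain ⟨t, hst, ht, htop⟩ := exists_subset_affineIndependent_affineSpan_eq_top
    (k := ℝ) (s := (s : Set E)) hs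
  have : Finite t := finite_set_of_fin_dim_affineIndependent ℝ ht
  have : Fintype t := Fintype.ofFinite t
  let b : AffineBasis t ℝ E := ⟨(↑), ht, by simpa using htop⟩
  refine ⟨∑ i : t, f i • b.coord i, fun v hv => ?_⟩
  have hsum : (∑ i : t, f i • b.coord i) v = ∑ i : t, f i * b.coord i v := by
    have : ∀ u : Finset t, (∑ i ∈ u, f i • b.coord i) v = ∑ i ∈ u, f i * b.coord i v := by
      intro u
      induction u using Finset.induction_on with
      | empty => simp
      | insert a u ha ih => simp [Finset.sum_insert ha, ih]
    exact this _
  rw [hsum, Finset.sum_eq_single ⟨v, hst hv⟩]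
  · have h1 : b.coord ⟨v, hst hv⟩ v = 1 := b.coord_apply_eq ⟨v, hst hv⟩
    rw [h1, mul_one]
  · intro j _ hj
    have h0 : b.coord j v = 0 := b.coord_apply_ne (j := ⟨v, hst hv⟩) hj
    rw [h0, mul_zero]
  · simp

/-- Piecewise linear interpolation on a simplicial complex. -/
theorem exists_interpolation [FiniteDimensional ℝ E] (K : Geometry.SimplicialComplex ℝ E)
    (f : E → ℝ) : ∃ H : E → ℝ, ∀ s ∈ K.faces, ∃ A : E →ᵃ[ℝ] ℝ,
      (∀ v ∈ s, A v = f v) ∧ Set.EqOn H A (convexHull ℝ (s : Set E)) := by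
  choose! A hA using fun (s : Finset E) (hs : s ∈ K.faces) => exists_affineMap_eqOn (K.indep hs) f
  have key : ∀ x, ∃ y : ℝ, ∀ s ∈ K.faces, x ∈ convexHull ℝ (s : Set E) → y = A s x := by
    intro x
    by_cases hx : ∃ s ∈ K.faces, x ∈ convexHull ℝ (s : Set E)
    · obtain ⟨s, hs, hxs⟩ := hx
      refine ⟨A s x, fun t ht hxt => ?_⟩
      -- Well-definedness on overlaps: two simplices meet in the hull of their common vertices,
      -- where both affine functions have the prescribed values.
      refine eqOn_convexHull_of_eqOn (A s) (A t) (s := (s ∩ t : Set E)) ?_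
        (K.inter_subset_convexHull hs ht ⟨hxs, hxt⟩)
      rintro v ⟨hv, hv'⟩
      rw [hA s hs v hv, hA t ht v hv']
    · exact ⟨0, fun s hs hxs => (hx ⟨s, hs, hxs⟩).elim⟩
  choose H hH using key
  exact ⟨H, fun s hs => ⟨A s, hA s hs, fun x hx => hH x s hs hx⟩⟩

end Complexes

/-! ### Triangulations of the unit square by vertical strips. -/

section Strips

open scoped Classical

/-- The point of the plane with given coordinates. -/
def pt (x y : ℝ) : Plane := !₂[x, y]

@[simp] theorem pt_zero (x y : ℝ) : pt x y 0 = x := rfl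

@[simp] theorem pt_one (x y : ℝ) : pt x y 1 = y := rfl

theorem plane_ext {p q : Plane} (h0 : p 0 = q 0) (h1 : p 1 = q 1) : p = q := by
  ext i; fin_cases i <;> assumption

theorem pt_eta (p : Plane) : pt (p 0) (p 1) = p := plane_ext rfl rfl

/-- The affine function `p ↦ a x + b y + d`. -/
def affineFn (a b d : ℝ) : Plane →ᵃ[ℝ] ℝ :=
  (a • (EuclideanSpace.proj (0 : Fin 2) : Plane →L[ℝ] ℝ).toLinearMap
    + b • (EuclideanSpace.proj (1 : Fin 2) : Plane →L[ℝ] ℝ).toLinearMap).toAffineMap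
    + AffineMap.const ℝ Plane d

@[simp] theorem affineFn_apply (a b d : ℝ) (p : Plane) :
    affineFn a b d p = a * p 0 + b * p 1 + d := by
  simp [affineFn]

theorem convex_unitSquare : Convex ℝ unitSquare := by
  intro p hp q hq a b ha hb hab i
  have := (convex_Icc (0 : ℝ) 1) (hp i) (hq i) ha hb hab
  simpa using this

theorem pt_mem_unitSquare {x y : ℝ} : pt x y ∈ unitSquare ↔ x ∈ Set.Icc (0 : ℝ) 1 ∧
    y ∈ Set.Icc (0 : ℝ) 1 := by
  simp only [unitSquare, Set.mem_ofPred_eq, Fin.forall_fin_two, pt_zero, pt_one]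

/-- A discrete intermediate value theorem, used to locate a point between two columns and between
two consecutive cross edges. -/
theorem exists_sign_change (g : ℕ → ℝ) {i₁ i₂ : ℕ} (hlt : i₁ < i₂) (h₁ : 0 ≤ g i₁)
    (h₂ : g i₂ ≤ 0) : ∃ i, i₁ ≤ i ∧ i < i₂ ∧ 0 ≤ g i ∧ g (i + 1) ≤ 0 := by
  induction i₂, hlt using Nat.le_induction with
  | base => exact ⟨i₁, le_rfl, Nat.lt_succ_self _, h₁, h₂⟩
  | succ j hj ih =>
    by_cases h : g j ≤ 0
    · obtain ⟨i, h1, h2, h3⟩ := ih h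
      exact ⟨i, h1, h2.trans (Nat.lt_succ_self _), h3⟩
    · exact ⟨j, (Nat.lt_of_succ_le hj).le, Nat.lt_succ_self _, (not_le.1 h).le, h₂⟩

theorem affineIndependent_pair {p q : Plane} (h : p ≠ q) :
    AffineIndependent ℝ ((↑) : ({p, q} : Finset Plane) → Plane) := by
  refine (affineIndependent_of_ne ℝ h).range.mono (s := (({p, q} : Finset Plane) : Set Plane)) ?_
  intro v hv
  simpa [Matrix.range_cons, or_comm] using hv

theorem affineIndependent_triple {p q r : Plane} (h : p ≠ q) (hpq : p 0 = q 0) (hr : r 0 ≠ p 0) :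
    AffineIndependent ℝ ((↑) : ({p, q, r} : Finset Plane) → Plane) := by
  let S : AffineSubspace ℝ Plane :=
    { carrier := {v | v 0 = p 0}
      smul_vsub_vadd_mem' := by
        intro c a b d ha hb hd
        simp only [Set.mem_ofPred_eq] at *
        simp [ha, hb, hd] }
  refine (affineIndependent_of_ne_of_mem_of_mem_of_notMem (k := ℝ) (s := S) h rfl hpq.symm
    (p₃ := r) hr).range.mono (s := (({p, q, r} : Finset Plane) : Set Plane)) ?_
  intro v hv
  simp only [Finset.coe_insert, Finset.coe_singleton, Set.mem_insert_iff,
    Set.mem_singleton_iff] at hv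
  simp only [Set.mem_range, Fin.exists_fin_succ]
  rcases hv with rfl | rfl | rfl <;> simp

/-- Edges of a subdivided vertical line meet properly. -/
theorem conformal_of_subset_column (x : ℝ) {y : ℕ → ℝ} (hy : StrictMono y) {d d' e e' : ℕ}
    (hd : d ≤ d') (hd' : d' ≤ d + 1) (he : e ≤ e') (he' : e' ≤ e + 1) {s t : Finset Plane}
    (hs : s ⊆ {pt x (y d), pt x (y d')}) (ht : t ⊆ {pt x (y e), pt x (y e')}) :
    Conformal s t := by
  -- Edges one above the other are separated by the horizontal line through the top of the lower
  -- one, and meet that line in at most this point.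
  have sep : ∀ {d d' e e' : ℕ}, d ≤ d' → e ≤ e' → d' ≤ e → ∀ {s t : Finset Plane},
      s ⊆ {pt x (y d), pt x (y d')} → t ⊆ {pt x (y e), pt x (y e')} → Conformal s t := by
    intro d d' e e' hd he hde s t hs ht
    refine conformal_of_separated (affineFn 0 1 (-y d')) (fun v hv => ?_) (fun v hv => ?_) ?_
    · have := hs hv
      simp only [Finset.mem_insert, Finset.mem_singleton] at this
      rcases this with rfl | rfl <;> simp [hy.monotone hd]
    · have := ht hv
      simp only [Finset.mem_insert, Finset.mem_singleton] at this
      rcases this with rfl | rfl <;> simp [hy.monotone hde, hy.monotone (hde.trans he)]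
    · have hne : pt x (y d') ≠ pt x (y d' + 1) := fun h => by
        have := congrArg (fun p : Plane => p 1) h
        simp at this
      refine conformal_of_affineIndependent (affineIndependent_pair hne) ?_ ?_
      · intro v hv
        rw [Finset.mem_filter] at hv
        have h2 := hv.2
        have := hs hv.1
        simp only [Finset.mem_insert, Finset.mem_singleton] at this ⊢
        left
        rcases this with rfl | rfl
        · simp only [affineFn_apply, pt_one] at h2
          rw [show y d = y d' by linarith]
        · rfl
      · intro v hv
        rw [Finset.mem_filter] at hv
        have h2 := hv.2
        have := ht hv.1
        simp only [Finset.mem_insert, Finset.mem_singleton] at this ⊢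
        left
        rcases this with rfl | rfl
        · simp only [affineFn_apply, pt_one] at h2
          rw [show y e = y d' by linarith]
        · simp only [affineFn_apply, pt_one] at h2
          rw [show y e' = y d' by linarith]
  by_cases h1 : d' ≤ e
  · exact sep hd he h1 hs ht
  by_cases h2 : e' ≤ d
  · exact (sep he hd h2 ht hs).symm
  obtain rfl : d = e := by omega
  obtain rfl : d' = d + 1 := by omega
  obtain rfl : e' = d + 1 := by omega
  refine conformal_of_affineIndependent (affineIndependent_pair fun h => ?_) hs ht
  have := congrArg (fun p : Plane => p 1) h
  simp only [pt_one] at this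
  exact absurd (hy.injective this) (by omega)

/-- Data for a triangulation of the unit square by vertical strips. The column at `X a` is
subdivided at the levels `Y a b`; the edges that cross the strip between the columns `a` and
`a + 1` join the levels `β a i` and `δ a i`, for `i = 0, …, len a`. -/
structure StripSystem where
  numStrips : ℕ
  X : ℕ → ℝ
  Y : ℕ → ℕ → ℝ
  β : ℕ → ℕ → ℕ
  δ : ℕ → ℕ → ℕ
  len : ℕ → ℕ
  X_strictMono : StrictMono X
  Y_strictMono : ∀ a, StrictMono (Y a)
  X_zero : X 0 = 0
  X_last : X numStrips = 1
  β_zero : ∀ a, β a 0 = 0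
  δ_zero : ∀ a, δ a 0 = 0
  β_mono : ∀ a, Monotone (β a)
  δ_mono : ∀ a, Monotone (δ a)
  step : ∀ a i, β a (i + 1) + δ a (i + 1) = β a i + δ a i + 1
  Y_zero : ∀ a, Y a 0 = 0
  Y_β_len : ∀ a < numStrips, Y a (β a (len a)) = 1
  Y_δ_len : ∀ a < numStrips, Y (a + 1) (δ a (len a)) = 1

namespace StripSystem

variable (S : StripSystem)

/-- The western end of a cross edge. -/
def west (a i : ℕ) : Plane := pt (S.X a) (S.Y a (S.β a i))

/-- The eastern end of a cross edge. -/
def east (a i : ℕ) : Plane := pt (S.X (a + 1)) (S.Y (a + 1) (S.δ a i))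

/-- The triangle between two consecutive cross edges (two of the four points coincide). -/
def tri (a i : ℕ) : Finset Plane := {S.west a i, S.west a (i + 1), S.east a i, S.east a (i + 1)}

theorem mem_tri {a i : ℕ} {v : Plane} : v ∈ S.tri a i ↔
    v = S.west a i ∨ v = S.west a (i + 1) ∨ v = S.east a i ∨ v = S.east a (i + 1) := by
  simp [tri]

/-- An affine function which vanishes on a cross edge and is positive above it. -/
def edgeFn (a i : ℕ) : Plane →ᵃ[ℝ] ℝ :=
  affineFn (S.Y a (S.β a i) - S.Y (a + 1) (S.δ a i)) (S.X (a + 1) - S.X a)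
    (S.X a * S.Y (a + 1) (S.δ a i) - S.X (a + 1) * S.Y a (S.β a i))

theorem X_lt (a : ℕ) : S.X a < S.X (a + 1) := S.X_strictMono (Nat.lt_succ_self a)

theorem edgeFn_west (a i j : ℕ) :
    S.edgeFn a i (S.west a j)
      = (S.X (a + 1) - S.X a) * (S.Y a (S.β a j) - S.Y a (S.β a i)) := by
  simp [edgeFn, west]; ring

theorem edgeFn_east (a i j : ℕ) :
    S.edgeFn a i (S.east a j)
      = (S.X (a + 1) - S.X a) * (S.Y (a + 1) (S.δ a j) - S.Y (a + 1) (S.δ a i)) := by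
  simp [edgeFn, east]; ring

theorem west_ne_east (a i j : ℕ) : S.west a i ≠ S.east a j := fun h => by
  have := congrArg (fun p : Plane => p 0) h
  simp only [west, east, pt_zero] at this
  exact (S.X_lt a).ne this

/-- By `step` exactly one of `β` and `δ` advances, so one end is shared and the other two points
form a vertical side. -/
theorem affineIndependent_tri (a i : ℕ) : AffineIndependent ℝ ((↑) : S.tri a i → Plane) := by
  have hs := S.step a i
  have hb := S.β_mono a (Nat.le_succ i)
  have hd := S.δ_mono a (Nat.le_succ i)
  have hX := (S.X_lt a).ne
  by_cases h : S.β a (i + 1) = S.β a i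
  · have hw : S.west a (i + 1) = S.west a i := by rw [west, h, west]
    have hne : S.east a i ≠ S.east a (i + 1) := fun h' => by
      have := congrArg (fun p : Plane => p 1) h'
      simp only [east, pt_one] at this
      have := (S.Y_strictMono (a + 1)).injective this
      omega
    have := affineIndependent_triple (r := S.west a i) hne rfl (by simpa [west, east] using hX)
    refine this.mono (s := (S.tri a i : Set Plane)) ?_
    intro v hv
    rw [Finset.mem_coe, mem_tri, hw] at hv
    simp only [Finset.coe_insert, Finset.coe_singleton, Set.mem_insert_iff, Set.mem_singleton_iff]
    tauto
  · have hw : S.east a (i + 1) = S.east a i := by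
      rw [east, show S.δ a (i + 1) = S.δ a i by simp only [Nat.succ_eq_add_one] at *; omega, east]
    have hne : S.west a i ≠ S.west a (i + 1) := fun h' => by
      have := congrArg (fun p : Plane => p 1) h'
      simp only [west, pt_one] at this
      exact h ((S.Y_strictMono a).injective this).symm
    have := affineIndependent_triple (r := S.east a i) hne rfl
      (by simpa [west, east] using hX.symm)
    refine this.mono (s := (S.tri a i : Set Plane)) ?_
    intro v hv
    rw [Finset.mem_coe, mem_tri, hw] at hv
    simp only [Finset.coe_insert, Finset.coe_singleton, Set.mem_insert_iff, Set.mem_singleton_iff]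
    tauto

/-- The cross edge `i + 1` separates the two triangles, and a vertex on its line must be one of its
two ends. -/
theorem conformal_same_strip (a : ℕ) {i j : ℕ} (hij : i < j) :
    Conformal (S.tri a i) (S.tri a j) := by
  have hX := sub_pos.2 (S.X_lt a)
  have hYa := S.Y_strictMono a
  have hYb := S.Y_strictMono (a + 1)
  have hlo : ∀ v ∈ S.tri a i, ∃ l ≤ i + 1, v = S.west a l ∨ v = S.east a l := by
    intro v hv
    rcases S.mem_tri.1 hv with h | h | h | h
    exacts [⟨i, Nat.le_succ i, .inl h⟩, ⟨i + 1, le_rfl, .inl h⟩, ⟨i, Nat.le_succ i, .inr h⟩,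
      ⟨i + 1, le_rfl, .inr h⟩]
  have hhi : ∀ v ∈ S.tri a j, ∃ l ≥ i + 1, v = S.west a l ∨ v = S.east a l := by
    intro v hv
    rcases S.mem_tri.1 hv with h | h | h | h
    exacts [⟨j, hij, .inl h⟩, ⟨j + 1, by omega, .inl h⟩, ⟨j, hij, .inr h⟩,
      ⟨j + 1, by omega, .inr h⟩]
  have hzero : ∀ l v, (v = S.west a l ∨ v = S.east a l) → S.edgeFn a (i + 1) v = 0 →
      v ∈ ({S.west a (i + 1), S.east a (i + 1)} : Finset Plane) := by
    rintro l v (rfl | rfl) h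
    · rw [edgeFn_west, mul_eq_zero, or_iff_right hX.ne', sub_eq_zero] at h
      simp [west, h]
    · rw [edgeFn_east, mul_eq_zero, or_iff_right hX.ne', sub_eq_zero] at h
      simp [east, h]
  refine conformal_of_separated (S.edgeFn a (i + 1)) ?_ ?_ ?_
  · intro v hv
    obtain ⟨l, hl, rfl | rfl⟩ := hlo v hv
    · rw [edgeFn_west]
      exact mul_nonpos_of_nonneg_of_nonpos hX.le
        (sub_nonpos.2 (hYa.monotone (S.β_mono a hl)))
    · rw [edgeFn_east]
      exact mul_nonpos_of_nonneg_of_nonpos hX.le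
        (sub_nonpos.2 (hYb.monotone (S.δ_mono a hl)))
  · intro v hv
    obtain ⟨l, hl, rfl | rfl⟩ := hhi v hv
    · rw [edgeFn_west]
      exact mul_nonneg hX.le (sub_nonneg.2 (hYa.monotone (S.β_mono a hl)))
    · rw [edgeFn_east]
      exact mul_nonneg hX.le (sub_nonneg.2 (hYb.monotone (S.δ_mono a hl)))
  · refine conformal_of_affineIndependent
      (affineIndependent_pair (S.west_ne_east a (i + 1) (i + 1))) ?_ ?_
    · intro v hv
      rw [Finset.mem_filter] at hv
      obtain ⟨l, -, h⟩ := hlo v hv.1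
      exact hzero l v h hv.2
    · intro v hv
      rw [Finset.mem_filter] at hv
      obtain ⟨l, -, h⟩ := hhi v hv.1
      exact hzero l v h hv.2

/-- The vertical line `x = X (a + 1)` separates the triangles. In adjacent strips their traces on it
are vertices or edges of the same subdivided column; otherwise the eastern trace is empty. -/
theorem conformal_of_strip_lt {a a' : ℕ} (h : a < a') (i j : ℕ) :
    Conformal (S.tri a i) (S.tri a' j) := by
  have hX := S.X_lt a
  have hX' := S.X_lt a'
  have hle : S.X (a + 1) ≤ S.X a' := S.X_strictMono.monotone h
  refine conformal_of_separated (affineFn 1 0 (-S.X (a + 1))) ?_ ?_ ?_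
  · intro v hv
    rcases S.mem_tri.1 hv with rfl | rfl | rfl | rfl <;> simp [west, east, hX.le]
  · intro v hv
    rcases S.mem_tri.1 hv with rfl | rfl | rfl | rfl <;> simp [west, east, hle, hle.trans hX'.le]
  · rcases Nat.eq_or_lt_of_le (Nat.succ_le_of_lt h) with rfl | h2
    · have e1 := S.step a i
      have e2 := S.step (a + 1) j
      have e3 := S.β_mono a (Nat.le_succ i)
      have e4 := S.δ_mono a (Nat.le_succ i)
      have e5 := S.β_mono (a + 1) (Nat.le_succ j)
      have e6 := S.δ_mono (a + 1) (Nat.le_succ j)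
      simp only [Nat.succ_eq_add_one] at *
      refine conformal_of_subset_column (S.X (a + 1)) (S.Y_strictMono (a + 1))
        (d := S.δ a i) (d' := S.δ a (i + 1)) (e := S.β (a + 1) j) (e' := S.β (a + 1) (j + 1))
        e4 (by omega) e5 (by omega) ?_ ?_
      · intro v hv
        rw [Finset.mem_filter, mem_tri] at hv
        simp only [Finset.mem_insert, Finset.mem_singleton]
        rcases hv with ⟨rfl | rfl | rfl | rfl, h0⟩
        · simp [west] at h0; linarith
        · simp [west] at h0; linarith
        · exact .inl rfl
        · exact .inr rfl
      · intro v hv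
        rw [Finset.mem_filter, mem_tri] at hv
        simp only [Finset.mem_insert, Finset.mem_singleton]
        rcases hv with ⟨rfl | rfl | rfl | rfl, h0⟩
        · exact .inl rfl
        · exact .inr rfl
        · simp [east] at h0; linarith
        · simp [east] at h0; linarith
    · have hlt : S.X (a + 1) < S.X a' := S.X_strictMono h2
      have hempty : (S.tri a' j).filter (fun v => affineFn 1 0 (-S.X (a + 1)) v = 0) = ∅ := by
        refine Finset.filter_eq_empty_iff.2 fun v hv h0 => ?_
        rcases S.mem_tri.1 hv with rfl | rfl | rfl | rfl <;> simp [west, east] at h0 <;> linarith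
      rw [hempty]
      simp [Conformal]

/-- All triangles of the strips. -/
def family : Set (Finset Plane) := {t | ∃ a < S.numStrips, ∃ i < S.len a, t = S.tri a i}

theorem conformal_family : ∀ s ∈ S.family, ∀ t ∈ S.family, Conformal s t := by
  rintro _ ⟨a, -, i, -, rfl⟩ _ ⟨b, -, j, -, rfl⟩
  rcases lt_trichotomy a b with h | rfl | h
  · exact S.conformal_of_strip_lt h i j
  · rcases lt_trichotomy i j with h | rfl | h
    · exact S.conformal_same_strip a h
    · exact conformal_of_affineIndependent (S.affineIndependent_tri a i) subset_rfl subset_rfl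
    · exact (S.conformal_same_strip a h).symm
  · exact (S.conformal_of_strip_lt h j i).symm

/-- The triangulation given by the strips. -/
def complex : Geometry.SimplicialComplex ℝ Plane :=
  complexOfFamily S.family (by rintro _ ⟨a, -, i, -, rfl⟩; exact S.affineIndependent_tri a i)
    S.conformal_family

theorem tri_mem_faces {a i : ℕ} (ha : a < S.numStrips) (hi : i < S.len a) :
    S.tri a i ∈ S.complex.faces :=
  ⟨⟨S.west a i, S.mem_tri.2 (.inl rfl)⟩, S.tri a i, ⟨a, ha, i, hi, rfl⟩, subset_rfl⟩

theorem finite_faces : S.complex.faces.Finite := by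
  have h : S.complex.faces ⊆ ⋃ a ∈ Finset.range S.numStrips, ⋃ i ∈ Finset.range (S.len a),
      ((S.tri a i).powerset : Set (Finset Plane)) := by
    rintro s ⟨-, _, ⟨a, ha, i, hi, rfl⟩, hs⟩
    simp only [Set.mem_iUnion]
    exact ⟨a, Finset.mem_range.2 ha, i, Finset.mem_range.2 hi, by simpa using hs⟩
  exact (Set.Finite.biUnion (Finset.finite_toSet _) fun a _ =>
    Set.Finite.biUnion (Finset.finite_toSet _) fun i _ => Finset.finite_toSet _).subset h

/-- A point of a strip between two cross edges lies in a triangle between them. -/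
theorem exists_mem_convexHull_tri {a i₁ i₂ : ℕ} {p : Plane} (h0 : S.X a ≤ p 0)
    (h1 : p 0 ≤ S.X (a + 1)) (hlt : i₁ < i₂) (h2 : 0 ≤ S.edgeFn a i₁ p)
    (h3 : S.edgeFn a i₂ p ≤ 0) :
    ∃ i, i₁ ≤ i ∧ i < i₂ ∧ p ∈ convexHull ℝ (S.tri a i : Set Plane) := by
  obtain ⟨i, hi1, hi2, hi3, hi4⟩ := exists_sign_change (fun i => S.edgeFn a i p) hlt h2 h3
  refine ⟨i, hi1, hi2, ?_⟩
  have hX := sub_pos.2 (S.X_lt a)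
  set D := S.X (a + 1) - S.X a with hD
  set u := (p 0 - S.X a) / D with hu
  have hu0 : 0 ≤ u := div_nonneg (by linarith) hX.le
  have hu1 : u ≤ 1 := (div_le_one hX).2 (by linarith)
  have hp0 : p 0 = S.X a + u * D := by rw [hu]; field_simp; ring
  have hconv := convex_convexHull ℝ (S.tri a i : Set Plane)
  have hmem : ∀ v ∈ S.tri a i, v ∈ convexHull ℝ (S.tri a i : Set Plane) := fun v hv =>
    subset_convexHull ℝ _ hv
  have hq : ∀ l, (l = i ∨ l = i + 1) →
      (1 - u) • S.west a l + u • S.east a l ∈ convexHull ℝ (S.tri a i : Set Plane) := by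
    intro l hl
    refine hconv (hmem _ ?_) (hmem _ ?_) (by linarith) hu0 (by ring)
    · rcases hl with rfl | rfl <;> simp [mem_tri]
    · rcases hl with rfl | rfl <;> simp [mem_tri]
  -- `f l` is the height at which cross edge `l` passes over the abscissa of `p`, and `u` is the
  -- position of `p` across the strip; so `p` lies on the vertical segment between two points of the
  -- triangle.
  set f : ℕ → ℝ := fun l => (1 - u) * S.Y a (S.β a l) + u * S.Y (a + 1) (S.δ a l) with hf
  have hE : ∀ l, S.edgeFn a l p = D * (p 1 - f l) := by
    intro l
    simp only [edgeFn, affineFn_apply, hf, hp0, hD]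
    ring
  simp only [hE] at hi3 hi4
  have hlo : f i ≤ p 1 := by
    by_contra h
    have := mul_neg_of_pos_of_neg hX (sub_neg.2 (not_le.1 h))
    linarith
  have hhi : p 1 ≤ f (i + 1) := by
    by_contra h
    have := mul_pos hX (sub_pos.2 (not_le.1 h))
    linarith
  have hx : ∀ l, ((1 - u) • S.west a l + u • S.east a l : Plane) 0 = p 0 := by
    intro l
    simp [west, east, hp0, hD]; ring
  have hy : ∀ l, ((1 - u) • S.west a l + u • S.east a l : Plane) 1 = f l := by
    intro l
    simp [west, east, hf]
  obtain ⟨v, w, hv, hw, hvw, hp⟩ : p 1 ∈ segment ℝ (f i) (f (i + 1)) := by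
    rw [segment_eq_Icc (hlo.trans hhi)]; exact ⟨hlo, hhi⟩
  have := hconv (hq i (.inl rfl)) (hq (i + 1) (.inr rfl)) hv hw hvw
  convert this using 1
  refine plane_ext ?_ ?_
  · rw [PiLp.add_apply, PiLp.smul_apply, PiLp.smul_apply, hx, hx, ← add_smul, hvw, one_smul]
  · rw [PiLp.add_apply, PiLp.smul_apply, PiLp.smul_apply, hy, hy, hp]

theorem edgeFn_zero_nonneg (a : ℕ) {p : Plane} (hp : p ∈ unitSquare) : 0 ≤ S.edgeFn a 0 p := by
  have hX := S.X_lt a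
  simp only [edgeFn, S.β_zero, S.δ_zero, S.Y_zero, affineFn_apply]
  have := mul_nonneg (sub_pos.2 hX).le (hp 1).1
  linarith

theorem edgeFn_len_nonpos {a : ℕ} (ha : a < S.numStrips) {p : Plane} (hp : p ∈ unitSquare) :
    S.edgeFn a (S.len a) p ≤ 0 := by
  have hX := S.X_lt a
  simp only [edgeFn, S.Y_β_len a ha, S.Y_δ_len a ha, affineFn_apply]
  have := mul_nonneg (sub_pos.2 hX).le (sub_nonneg.2 (hp 1).2)
  linarith

theorem len_pos {a : ℕ} (ha : a < S.numStrips) : 0 < S.len a := by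
  rcases Nat.eq_zero_or_pos (S.len a) with h | h
  · have := S.Y_β_len a ha
    rw [h, S.β_zero, S.Y_zero] at this
    norm_num at this
  · exact h

theorem exists_tri_of_mem_strip {a : ℕ} (ha : a < S.numStrips) {p : Plane} (hp : p ∈ unitSquare)
    (h0 : S.X a ≤ p 0) (h1 : p 0 ≤ S.X (a + 1)) :
    ∃ i < S.len a, p ∈ convexHull ℝ (S.tri a i : Set Plane) := by
  obtain ⟨i, -, hi, h⟩ := S.exists_mem_convexHull_tri h0 h1 (S.len_pos ha)
    (S.edgeFn_zero_nonneg a hp) (S.edgeFn_len_nonpos ha hp)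
  exact ⟨i, hi, h⟩

theorem tri_subset_unitSquare {a i : ℕ} (ha : a < S.numStrips) (hi : i < S.len a) :
    (S.tri a i : Set Plane) ⊆ unitSquare := by
  have hX : ∀ b ≤ S.numStrips, S.X b ∈ Set.Icc (0 : ℝ) 1 := fun b hb =>
    ⟨S.X_zero ▸ S.X_strictMono.monotone (Nat.zero_le b), S.X_last ▸ S.X_strictMono.monotone hb⟩
  have hw : ∀ l ≤ S.len a, S.west a l ∈ unitSquare := fun l hl =>
    pt_mem_unitSquare.2 ⟨hX a ha.le, S.Y_zero a ▸ (S.Y_strictMono a).monotone (Nat.zero_le _),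
      S.Y_β_len a ha ▸ (S.Y_strictMono a).monotone (S.β_mono a hl)⟩
  have he : ∀ l ≤ S.len a, S.east a l ∈ unitSquare := fun l hl =>
    pt_mem_unitSquare.2 ⟨hX _ ha, S.Y_zero (a + 1) ▸
      (S.Y_strictMono (a + 1)).monotone (Nat.zero_le _),
      S.Y_δ_len a ha ▸ (S.Y_strictMono (a + 1)).monotone (S.δ_mono a hl)⟩
  intro v hv
  rcases S.mem_tri.1 hv with rfl | rfl | rfl | rfl
  exacts [hw _ hi.le, hw _ hi, he _ hi.le, he _ hi]

theorem space_complex : S.complex.space = unitSquare := by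
  refine Set.Subset.antisymm ?_ ?_
  · intro p hp
    obtain ⟨s, ⟨-, _, ⟨a, ha, i, hi, rfl⟩, hs⟩, hps⟩ :=
      Geometry.SimplicialComplex.mem_space_iff.1 hp
    exact convexHull_min (S.tri_subset_unitSquare ha hi) convex_unitSquare
      (convexHull_mono (by exact_mod_cast hs) hps)
  · intro p hp
    have hpos : 0 < S.numStrips := by
      rcases Nat.eq_zero_or_pos S.numStrips with h | h
      · have := S.X_last
        rw [h, S.X_zero] at this
        norm_num at this
      · exact h
    obtain ⟨a, -, ha, h0, h1⟩ := exists_sign_change (fun a => p 0 - S.X a) hpos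
      (by simpa [S.X_zero] using (hp 0).1) (by simpa [S.X_last] using (hp 0).2)
    obtain ⟨i, hi, hpi⟩ := S.exists_tri_of_mem_strip ha hp (sub_nonneg.1 h0) (sub_nonpos.1 h1)
    exact Geometry.SimplicialComplex.mem_space_iff.2 ⟨_, S.tri_mem_faces ha hi, hpi⟩

/-- The terrain over the triangulation with given heights of the vertices. -/
theorem exists_terrain (f : Plane → ℝ) : ∃ T : Terrain, T.triangulation = S.complex ∧
    ∀ a < S.numStrips, ∀ i < S.len a, ∃ A : Plane →ᵃ[ℝ] ℝ, (∀ v ∈ S.tri a i, A v = f v) ∧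
      Set.EqOn T.height A (convexHull ℝ (S.tri a i : Set Plane)) := by
  obtain ⟨H, hH⟩ := exists_interpolation S.complex f
  exact ⟨⟨S.complex, S.finite_faces, S.space_complex, H, fun s hs =>
    (hH s hs).imp fun A hA => hA.2⟩, rfl, fun a ha i hi => hH _ (S.tri_mem_faces ha hi)⟩

theorem exists_of_mem_vertices {v : Plane} (hv : v ∈ S.complex.vertices) :
    ∃ a < S.numStrips, ∃ i ≤ S.len a, v = S.west a i ∨ v = S.east a i := by
  obtain ⟨-, _, ⟨a, ha, i, hi, rfl⟩, hs⟩ := hv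
  rcases S.mem_tri.1 (hs (Finset.mem_singleton_self v)) with h | h | h | h
  exacts [⟨a, ha, i, hi.le, .inl h⟩, ⟨a, ha, i + 1, hi, .inl h⟩, ⟨a, ha, i, hi.le, .inr h⟩,
    ⟨a, ha, i + 1, hi, .inr h⟩]

end StripSystem

end Strips

/-! ### Construction of farming terrains with few vertices. -/

section Existence

open scoped Classical

theorem dist_le_abs_add_abs (p q : Plane) : dist p q ≤ |p 0 - q 0| + |p 1 - q 1| := by
  rw [EuclideanSpace.dist_eq, Fin.sum_univ_two, Real.dist_eq, Real.dist_eq]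
  refine Real.sqrt_le_iff.2 ⟨by positivity, ?_⟩
  nlinarith [mul_nonneg (abs_nonneg (p 0 - q 0)) (abs_nonneg (p 1 - q 1))]

theorem exists_strictMono_enumeration (L : Finset ℝ) (h0 : (0 : ℝ) ∈ L) (h1 : (1 : ℝ) ∈ L)
    (hL : ∀ x ∈ L, x ∈ Set.Icc (0 : ℝ) 1) : ∃ (y : ℕ → ℝ) (N : ℕ), StrictMono y ∧ y 0 = 0 ∧
      y N = 1 ∧ N + 1 = L.card ∧ ∀ x ∈ L, ∃ b ≤ N, y b = x := by
  have hpos : 0 < L.card := Finset.card_pos.2 ⟨0, h0⟩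
  let g := L.orderEmbOfFin rfl
  -- Beyond the list the values are arbitrary; `1 + b` exceeds 1 and keeps the sequence strictly
  -- increasing.
  let y : ℕ → ℝ := fun b => if hb : b < L.card then g ⟨b, hb⟩ else 1 + b
  have hg : ∀ b, g b ∈ Set.Icc (0 : ℝ) 1 := fun b => hL _ (L.orderEmbOfFin_mem rfl b)
  have hy : StrictMono y := by
    intro a b hab
    by_cases hb : b < L.card
    · simp only [y, hb, hab.trans hb, dif_pos]
      exact g.strictMono (by simpa using hab)
    · by_cases ha : a < L.card
      · simp only [y, hb, ha, dif_pos, dif_neg, not_false_eq_true]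
        have : (0 : ℝ) < b := by exact_mod_cast hpos.trans_le (not_lt.1 hb)
        linarith [(hg ⟨a, ha⟩).2]
      · simp only [y, hb, ha, dif_neg, not_false_eq_true]
        have : (a : ℝ) < b := by exact_mod_cast hab
        linarith
  have hsurj : ∀ x ∈ L, ∃ b ≤ L.card - 1, y b = x := by
    intro x hx
    obtain ⟨b, hb⟩ : x ∈ Set.range g := by
      rw [Finset.range_orderEmbOfFin]; exact hx
    refine ⟨b, by omega, ?_⟩
    simp only [y, b.2, dif_pos]
    exact hb
  have hmem : ∀ b < L.card, y b ∈ Set.Icc (0 : ℝ) 1 := by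
    intro b hb
    simp only [y, hb, dif_pos]
    exact hg _
  refine ⟨y, L.card - 1, hy, ?_, ?_, by omega, hsurj⟩
  · obtain ⟨b, -, hb⟩ := hsurj 0 h0
    exact le_antisymm (hb ▸ hy.monotone (Nat.zero_le b)) (hmem 0 hpos).1
  · obtain ⟨b, hb', hb⟩ := hsurj 1 h1
    exact le_antisymm (hmem _ (by omega)).2 (hb ▸ hy.monotone hb')

theorem ridgesWidth_pos {c : ℝ} (hc : 0 < c) (n : ℕ) : 0 < ridgesWidth c n := by
  unfold ridgesWidth; positivity

theorem ridgeLine_zero (c : ℝ) (n : ℕ) : ridgeLine c n 0 = ridgesWest c n := by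
  simp [ridgeLine]

theorem ridgeLine_last (c : ℝ) {n : ℕ} (hn : 1 ≤ n) : ridgeLine c n (2 * n) = 1 := by
  have : (n : ℝ) ≠ 0 := by positivity
  simp only [ridgeLine, ridgesWest]
  push_cast
  field_simp
  ring

theorem ridgeLine_succ (c : ℝ) (n j : ℕ) :
    ridgeLine c n (j + 1) = ridgeLine c n j + ridgesWidth c n / (2 * n) := by
  simp only [ridgeLine]; push_cast; ring

theorem ridgeLine_strictMono {c : ℝ} (hc : 0 < c) {n : ℕ} (hn : 1 ≤ n) :
    StrictMono (ridgeLine c n) := by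
  refine strictMono_nat_of_lt_succ fun j => ?_
  have := ridgesWidth_pos hc n
  have : (0 : ℝ) < n := by exact_mod_cast hn
  rw [ridgeLine_succ]
  have : 0 < ridgesWidth c n / (2 * n) := by positivity
  linarith

/-- The columns of the triangulation of a farming terrain. -/
def columnX (c : ℝ) (n m : ℕ) (d : ℝ) : ℕ → ℝ
  | 0 => 0
  | 1 => farmSide c m
  | 2 => farmSide c m + d
  | 3 => ridgesWest c n - d
  | j + 4 => ridgeLine c n j

theorem columnX_strictMono {c : ℝ} (hc : 0 < c) {n m : ℕ} (hn : 1 ≤ n) {d : ℝ} (hd : 0 < d)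
    (hs : 0 < farmSide c m) (hw : farmSide c m + d < ridgesWest c n - d) :
    StrictMono (columnX c n m d) := by
  refine strictMono_nat_of_lt_succ fun a => ?_
  match a with
  | 0 => exact hs
  | 1 => simp only [columnX]; linarith
  | 2 => exact hw
  | 3 => simp only [columnX, ridgeLine_zero]; linarith
  | j + 4 => exact ridgeLine_strictMono hc hn (Nat.lt_succ_self j)

/-- The triangulation of a farming terrain: a grid west of the first ridge, a fan of triangles on
the first rectangle of the ridges, and two triangles on each of the other rectangles. -/
def farmingStrips {c : ℝ} (hc : 0 < c) {n m : ℕ} (hn : 1 ≤ n) {d : ℝ} (hd : 0 < d)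
    (hs : 0 < farmSide c m) (hw : farmSide c m + d < ridgesWest c n - d)
    {y : ℕ → ℝ} (hy : StrictMono y) (hy0 : y 0 = 0) {N : ℕ} (hyN : y N = 1) : StripSystem where
  numStrips := 4 + 2 * n
  X := columnX c n m d
  -- From column 5 on only the levels 0 and 1 occur. In strip 4 the cross edges first run through
  -- all western levels from the south-east corner, then make one step in the east: this fan is what
  -- keeps the vertex count linear in `n` instead of of order `n k`. In the other strips horizontal
  -- and diagonal edges alternate.
  Y a b := if a ≤ 4 then y b else b
  β a i := if a = 4 then min i N else i / 2
  δ a i := if a = 4 then i - N else (i + 1) / 2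
  len a := if a < 4 then 2 * N else if a = 4 then N + 1 else 2
  X_strictMono := columnX_strictMono hc hn hd hs hw
  Y_strictMono a := by
    by_cases h : a ≤ 4
    · simpa [h] using hy
    · simpa [h] using Nat.strictMono_cast
  X_zero := rfl
  X_last := by rw [add_comm]; exact ridgeLine_last c hn
  β_zero a := by split_ifs <;> simp
  δ_zero a := by split_ifs <;> simp
  β_mono a i j h := by dsimp only; split_ifs <;> omega
  δ_mono a i j h := by dsimp only; split_ifs <;> omega
  step a i := by split_ifs <;> omega
  Y_zero a := by split_ifs <;> simp [hy0]
  Y_β_len a _ := by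
    rcases lt_trichotomy a 4 with h | rfl | h
    · simp [h, h.le, h.ne, hyN]
    · simp [hyN]
    · simp [not_le.2 h, h.not_gt, h.ne']
  Y_δ_len a _ := by
    rcases lt_trichotomy a 4 with h | rfl | h
    · simp [h, Nat.succ_le_of_lt h, h.ne, show (2 * N + 1) / 2 = N by omega, hyN]
    · simp
    · simp [show ¬ a + 1 ≤ 4 by omega, h.not_gt, h.ne']

/-- The prescribed heights of the vertices of a farming terrain. -/
def vertexHeight (c : ℝ) (n m k : ℕ) (ω d h : ℝ) (v : Plane) : ℝ :=
  if v 0 < ridgesWest c n then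
    -- The roads are widened by `d`, so that even for `ω = 0` a grid row of positive width lies at
    -- height `h`.
    if ∃ i < k, v ∈ farm c m i ∪ road c n m (ω + d) i then h else 0
  else if ∃ j, Odd j ∧ v 0 = ridgeLine c n j then h + ridgesWidth c n / (2 * n) else h

theorem vertexHeight_even {c : ℝ} (hc : 0 < c) {n : ℕ} (hn : 1 ≤ n) (m k : ℕ) (ω d h : ℝ)
    {v : Plane} {j : ℕ} (hj : Even j) (hv : v 0 = ridgeLine c n j) :
    vertexHeight c n m k ω d h v = h := by
  have hmono := ridgeLine_strictMono hc hn
  have h1 : ¬ v 0 < ridgesWest c n := by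
    rw [hv, ← ridgeLine_zero]; exact not_lt.2 (hmono.monotone (Nat.zero_le j))
  have h2 : ¬ ∃ j, Odd j ∧ v 0 = ridgeLine c n j := by
    rintro ⟨l, hl, hvl⟩
    obtain rfl := hmono.injective (hv.symm.trans hvl)
    exact (Nat.not_odd_iff_even.2 hj) hl
  rw [vertexHeight, if_neg h1, if_neg h2]

theorem vertexHeight_odd {c : ℝ} (hc : 0 < c) {n : ℕ} (hn : 1 ≤ n) (m k : ℕ) (ω d h : ℝ)
    {v : Plane} {j : ℕ} (hj : Odd j) (hv : v 0 = ridgeLine c n j) :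
    vertexHeight c n m k ω d h v = h + ridgesWidth c n / (2 * n) := by
  have hmono := ridgeLine_strictMono hc hn
  have h1 : ¬ v 0 < ridgesWest c n := by
    rw [hv, ← ridgeLine_zero]; exact not_lt.2 (hmono.monotone (Nat.zero_le j))
  rw [vertexHeight, if_neg h1, if_pos ⟨j, hj, hv⟩]

/-- The levels at which the columns west of the ridges are subdivided. -/
def levels (c : ℝ) (m k : ℕ) (ω d : ℝ) : Finset ℝ :=
  {0, 1} ∪ (Finset.range k).biUnion fun i =>
    {farmSouth c m i - d, farmSouth c m i, farmSouth c m i + ω + d, farmSouth c m i + ω + 2 * d,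
      farmSouth c m i + farmSide c m, farmSouth c m i + farmSide c m + d}

theorem card_levels_le (c : ℝ) (m k : ℕ) (ω d : ℝ) : (levels c m k ω d).card ≤ 6 * k + 2 := by
  refine (Finset.card_union_le _ _).trans ?_
  have h1 : ({0, 1} : Finset ℝ).card ≤ 2 := Finset.card_le_two
  have h2 := Finset.card_biUnion_le_card_mul (Finset.range k) (fun i =>
    ({farmSouth c m i - d, farmSouth c m i, farmSouth c m i + ω + d,
      farmSouth c m i + ω + 2 * d, farmSouth c m i + farmSide c m,
      farmSouth c m i + farmSide c m + d} : Finset ℝ)) 6 fun i _ => Finset.card_le_six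
  rw [Finset.card_range] at h2
  omega

theorem farmSouth_bounds {c : ℝ} {m k : ℕ} (hs : 0 < farmSide c m) (hk : 3 * k * farmSide c m ≤ 1)
    {i : ℕ} (hi : i < k) :
    farmSide c m ≤ farmSouth c m i ∧ farmSouth c m i + 2 * farmSide c m ≤ 1 := by
  have hik : (i : ℝ) + 1 ≤ k := by exact_mod_cast hi
  have h0 : (0 : ℝ) ≤ i := Nat.cast_nonneg i
  unfold farmSouth
  constructor <;> nlinarith

/-- The existence of farming terrains with few vertices. -/
theorem exists_isFarmingTerrain {c : ℝ} (hc : 0 < c) {n m k : ℕ} (hn : 1 ≤ n) {ω ε h : ℝ}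
    (hs : 0 < farmSide c m) (hk : 3 * k * farmSide c m ≤ 1) (hω : 0 ≤ ω) (hε : 0 < ε)
    (hωε : ω + ε ≤ farmSide c m) (hw : farmSide c m + ε < ridgesWest c n) (hh : 0 ≤ h) :
    ∃ T : Terrain, IsFarmingTerrain T c n m k ω ε h ∧
      T.triangulation.vertices.ncard ≤ 5 * (6 * k + 2) + 4 * n := by
  -- Slopes extend at most `d` beyond farms and ridges and `2 d` beyond roads, so `4 d` leaves room
  -- even when distances are estimated by the sum of the coordinate differences.
  obtain ⟨d, rfl⟩ : ∃ d, ε = 4 * d := ⟨ε / 4, by ring⟩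
  have hd : 0 < d := by linarith
  have hlev : ∀ x ∈ levels c m k ω d, x ∈ Set.Icc (0 : ℝ) 1 := by
    intro x hx
    simp only [levels, Finset.mem_union, Finset.mem_insert, Finset.mem_singleton,
      Finset.mem_biUnion, Finset.mem_range] at hx
    rcases hx with (rfl | rfl) | ⟨i, hi, hx⟩
    · simp
    · simp
    · obtain ⟨h1, h2⟩ := farmSouth_bounds hs hk hi
      rcases hx with rfl | rfl | rfl | rfl | rfl | rfl <;> constructor <;> linarith
  obtain ⟨y, N, hy, hy0, hyN, hN, hsurj⟩ := exists_strictMono_enumeration (levels c m k ω d)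
    (by simp [levels]) (by simp [levels]) hlev
  have hlevel : ∀ i < k, ∀ x ∈ ({farmSouth c m i - d, farmSouth c m i, farmSouth c m i + ω + d,
      farmSouth c m i + ω + 2 * d, farmSouth c m i + farmSide c m,
      farmSouth c m i + farmSide c m + d} : Finset ℝ), ∃ b ≤ N, y b = x := fun i hi x hx =>
    hsurj x (Finset.mem_union_right _ (Finset.mem_biUnion.2 ⟨i, Finset.mem_range.2 hi, hx⟩))
  let S := farmingStrips hc hn hd hs (by linarith) hy hy0 hyN
  have hSn : S.numStrips = 4 + 2 * n := rfl
  have hX0 : S.X 0 = 0 := rfl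
  have hX1 : S.X 1 = farmSide c m := rfl
  have hX2 : S.X 2 = farmSide c m + d := rfl
  have hX3 : S.X 3 = ridgesWest c n - d := rfl
  have hXr : ∀ j, S.X (4 + j) = ridgeLine c n j := fun j => by rw [add_comm]; rfl
  have hX4 : S.X 4 = ridgesWest c n := ridgeLine_zero c n
  have hlen : ∀ a < 4, S.len a = 2 * N := fun a ha => if_pos ha
  have hXm := S.X_strictMono
  -- the triangles of the grid west of the ridges
  have htri : ∀ a < 4, ∀ i, ∀ v ∈ S.tri a i, (v 0 = S.X a ∨ v 0 = S.X (a + 1)) ∧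
      (v 1 = y (i / 2) ∨ v 1 = y (i / 2 + 1)) := by
    intro a ha i v hv
    have hY1 : ∀ b, S.Y a b = y b := fun b => if_pos ha.le
    have hY2 : ∀ b, S.Y (a + 1) b = y b := fun b => if_pos ha
    have hβ : ∀ i, S.β a i = i / 2 := fun i => if_neg ha.ne
    have hδ : ∀ i, S.δ a i = (i + 1) / 2 := fun i => if_neg ha.ne
    have e1 : (i + 1) / 2 = i / 2 ∨ (i + 1) / 2 = i / 2 + 1 := by omega
    have e2 : (i + 1 + 1) / 2 = i / 2 + 1 := by omega
    rcases S.mem_tri.1 hv with rfl | rfl | rfl | rfl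
    · exact ⟨.inl rfl, .inl (by simp [StripSystem.west, hY1, hβ])⟩
    · refine ⟨.inl rfl, ?_⟩
      simp only [StripSystem.west, hY1, hβ, pt_one]
      rcases e1 with e | e <;> simp [e]
    · refine ⟨.inr rfl, ?_⟩
      simp only [StripSystem.east, hY2, hδ, pt_one]
      rcases e1 with e | e <;> simp [e]
    · exact ⟨.inr rfl, .inr (by simp [StripSystem.east, hY2, hδ, e2])⟩
  have hbox : ∀ a < 4, ∀ b₁ b₂, b₁ < b₂ → b₂ ≤ N → ∀ p : Plane, S.X a ≤ p 0 → p 0 ≤ S.X (a + 1) →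
      y b₁ ≤ p 1 → p 1 ≤ y b₂ → ∃ i < S.len a, p ∈ convexHull ℝ (S.tri a i : Set Plane) ∧
        ∀ v ∈ S.tri a i, (v 0 = S.X a ∨ v 0 = S.X (a + 1)) ∧ y b₁ ≤ v 1 ∧ v 1 ≤ y b₂ := by
    intro a ha b₁ b₂ hb hbN p h0 h1 h2 h3
    -- In the grid the even cross edges are the horizontal ones, at level `y b`.
    have hE : ∀ b, S.edgeFn a (2 * b) p = (S.X (a + 1) - S.X a) * (p 1 - y b) := by
      intro b
      have hY1 : S.Y a (S.β a (2 * b)) = y b := by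
        rw [show S.Y a (S.β a (2 * b)) = y (S.β a (2 * b)) from if_pos ha.le,
          show S.β a (2 * b) = 2 * b / 2 from if_neg ha.ne]
        simp
      have hY2 : S.Y (a + 1) (S.δ a (2 * b)) = y b := by
        rw [show S.Y (a + 1) (S.δ a (2 * b)) = y (S.δ a (2 * b)) from if_pos ha,
          show S.δ a (2 * b) = (2 * b + 1) / 2 from if_neg ha.ne]
        congr 1; omega
      rw [StripSystem.edgeFn, hY1, hY2, affineFn_apply]
      ring
    have hXp := sub_pos.2 (S.X_lt a)
    obtain ⟨i, hi1, hi2, hpi⟩ := S.exists_mem_convexHull_tri h0 h1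
      (show 2 * b₁ < 2 * b₂ by omega)
      (by rw [hE]; exact mul_nonneg hXp.le (sub_nonneg.2 h2))
      (by rw [hE]; exact mul_nonpos_of_nonneg_of_nonpos hXp.le (sub_nonpos.2 h3))
    refine ⟨i, by rw [hlen a ha]; omega, hpi, fun v hv => ⟨(htri a ha i v hv).1, ?_⟩⟩
    have m1 : y b₁ ≤ y (i / 2) := hy.monotone (by omega)
    have m2 : y (i / 2 + 1) ≤ y b₂ := hy.monotone (by omega)
    have m3 : y (i / 2) ≤ y (i / 2 + 1) := hy.monotone (by omega)
    rcases (htri a ha i v hv).2 with e | e <;> rw [e] <;> constructor <;> linarith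
  have hcell : ∀ a < 4, ∀ i, ∀ p ∈ convexHull ℝ (S.tri a i : Set Plane),
      y (i / 2) ≤ p 1 ∧ p 1 ≤ y (i / 2 + 1) := by
    intro a ha i p hp
    have m3 : y (i / 2) ≤ y (i / 2 + 1) := hy.monotone (by omega)
    have := affineMap_mem_of_mem_convexHull (affineFn 0 1 0)
      (convex_Icc (y (i / 2)) (y (i / 2 + 1))) (fun v hv => by
        rcases (htri a ha i v hv).2 with e | e <;> simp [e, m3]) hp
    simpa using this
  have hwest : ∀ p ∈ unitSquare, p 0 < ridgesWest c n → ∃ a < 4, S.X a ≤ p 0 ∧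
      p 0 ≤ S.X (a + 1) ∧ ∃ i < S.len a, p ∈ convexHull ℝ (S.tri a i : Set Plane) := by
    intro p hp hpw
    obtain ⟨a, -, ha, h0, h1⟩ := exists_sign_change (fun a => p 0 - S.X a) (show 0 < 4 by norm_num)
      (by simpa [hX0] using (hp 0).1) (by simpa [hX4] using hpw.le)
    exact ⟨a, ha, sub_nonneg.1 h0, sub_nonpos.1 h1, S.exists_tri_of_mem_strip
      (by rw [hSn]; omega) hp (sub_nonneg.1 h0) (sub_nonpos.1 h1)⟩
  set f := vertexHeight c n m k ω d h with hf
  have hfw : ∀ v : Plane, v 0 = ridgesWest c n → f v = h := fun v hv =>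
    vertexHeight_even hc hn m k ω d h Even.zero (hv.trans (ridgeLine_zero c n).symm)
  have hfhigh : ∀ v : Plane, v 0 < ridgesWest c n →
      (∃ i < k, v ∈ farm c m i ∪ road c n m (ω + d) i) → f v = h := fun v hv hv' => by
    rw [hf, vertexHeight, if_pos hv, if_pos hv']
  obtain ⟨T, hT, hH⟩ := S.exists_terrain f
  have hval : ∀ a < 4 + 2 * n, ∀ i < S.len a, ∀ p ∈ convexHull ℝ (S.tri a i : Set Plane),
      ∀ I : Set ℝ, Convex ℝ I → (∀ v ∈ S.tri a i, f v ∈ I) → T.height p ∈ I := by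
    intro a ha i hi p hp I hI hv
    obtain ⟨A, hA, hTA⟩ := hH a ha i hi
    rw [hTA hp]
    exact affineMap_mem_of_mem_convexHull A hI (fun v h => by rw [hA v h]; exact hv v h) hp
  -- On a ridge rectangle the vertices lie on its two long sides, and each side has constant height;
  -- hence fan and diagonal triangulations give the same function.
  have hridge : ∀ j < 2 * n, ∀ p ∈ unitSquare,
      p 0 ∈ Set.Icc (ridgeLine c n j) (ridgeLine c n (j + 1)) → ∀ B : Plane →ᵃ[ℝ] ℝ,
      (∀ v : Plane, v 0 = ridgeLine c n j → f v = B v) →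
      (∀ v : Plane, v 0 = ridgeLine c n (j + 1) → f v = B v) → T.height p = B p := by
    intro j hj p hp hpj B hB1 hB2
    obtain ⟨i, hi, hpi⟩ := S.exists_tri_of_mem_strip (a := 4 + j) (by rw [hSn]; omega) hp
      (by rw [hXr]; exact hpj.1) (by rw [add_assoc, hXr]; exact hpj.2)
    obtain ⟨A, hA, hTA⟩ := hH (4 + j) (by rw [hSn]; omega) i hi
    rw [hTA hpi]
    refine eqOn_convexHull_of_eqOn A B (fun v hv => ?_) hpi
    rw [hA v hv]
    have hxj : S.X (4 + j) = ridgeLine c n j := hXr j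
    have hxj' : S.X (4 + j + 1) = ridgeLine c n (j + 1) := hXr (j + 1)
    rcases S.mem_tri.1 hv with rfl | rfl | rfl | rfl
    exacts [hB1 _ hxj, hB1 _ hxj, hB2 _ hxj', hB2 _ hxj']
  refine ⟨T, ⟨?_, ?_, ?_, ?_, ?_⟩, ?_⟩
  · rintro i hi p (⟨hp0, hp1⟩ | ⟨hp0, hp1⟩)
    · obtain ⟨b₁, hb₁, e₁⟩ := hlevel i hi (farmSouth c m i) (by simp)
      obtain ⟨b₂, hb₂, e₂⟩ := hlevel i hi (farmSouth c m i + farmSide c m) (by simp)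
      obtain ⟨l, hl, hpl, hv⟩ := hbox 0 (by norm_num) b₁ b₂
        (hy.lt_iff_lt.1 (by rw [e₁, e₂]; linarith)) hb₂ p hp0.1 hp0.2 (e₁ ▸ hp1.1) (e₂ ▸ hp1.2)
      refine hval 0 (by omega) l hl p hpl {h} (convex_singleton h) fun v hvl => ?_
      obtain ⟨h0, h1, h2⟩ := hv v hvl
      rw [e₁] at h1
      rw [e₂] at h2
      rw [zero_add, hX0, hX1] at h0
      refine hfhigh v ?_ ⟨i, hi, .inl ⟨?_, h1, h2⟩⟩
      · rcases h0 with e | e <;> linarith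
      · rcases h0 with e | e <;> rw [e] <;> constructor <;> linarith
    · obtain ⟨b₁, hb₁, e₁⟩ := hlevel i hi (farmSouth c m i) (by simp)
      obtain ⟨b₂, hb₂, e₂⟩ := hlevel i hi (farmSouth c m i + ω + d) (by simp)
      obtain ⟨a, ha1, ha, h0, h1⟩ := exists_sign_change (fun a => p 0 - S.X a)
        (show 1 < 4 by norm_num) (by simpa [hX1] using hp0.1) (by simpa [hX4] using hp0.2)
      obtain ⟨l, hl, hpl, hv⟩ := hbox a ha b₁ b₂
        (hy.lt_iff_lt.1 (by rw [e₁, e₂]; linarith)) hb₂ p (sub_nonneg.1 h0) (sub_nonpos.1 h1)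
        (e₁ ▸ hp1.1) (by rw [e₂]; linarith [hp1.2])
      refine hval a (by omega) l hl p hpl {h} (convex_singleton h) fun v hvl => ?_
      obtain ⟨h0, h1, h2⟩ := hv v hvl
      rw [e₁] at h1
      rw [e₂] at h2
      have m1 : farmSide c m ≤ S.X a := hX1 ▸ hXm.monotone ha1
      have m2 : S.X (a + 1) ≤ ridgesWest c n := hX4 ▸ hXm.monotone ha
      have m3 := S.X_lt a
      have m4 : farmSide c m ≤ v 0 ∧ v 0 ≤ ridgesWest c n := by
        rcases h0 with e | e <;> rw [e] <;> constructor <;> linarith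
      rcases m4.2.eq_or_lt with e | hlt
      · exact hfw v e
      · exact hfhigh v hlt ⟨i, hi, .inr ⟨m4, h1, by linarith⟩⟩
  · intro j hj hje p hp hpj
    rw [hridge j hj p hp hpj (affineFn 1 0 (h - ridgeLine c n j))]
    · simp; ring
    · intro v hv
      rw [hf, vertexHeight_even hc hn m k ω d h hje hv]
      simp [hv]
    · intro v hv
      rw [hf, vertexHeight_odd hc hn m k ω d h hje.add_one hv]
      simp only [affineFn_apply, hv, ridgeLine_succ]; ring
  · intro j hj hjo p hp hpj
    rw [hridge j hj p hp hpj (affineFn (-1) 0 (h + ridgeLine c n (j + 1)))]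
    · simp; ring
    · intro v hv
      rw [hf, vertexHeight_odd hc hn m k ω d h hjo hv]
      simp only [affineFn_apply, hv, ridgeLine_succ]; ring
    · intro v hv
      rw [hf, vertexHeight_even hc hn m k ω d h hjo.add_one hv]
      simp [hv]
  · intro p hp hfar
    have hpw : p 0 < ridgesWest c n := by
      by_contra hcon
      have := hfar p (.inr ⟨hp, not_lt.1 hcon⟩)
      rw [dist_self] at this
      linarith
    have hfar' : ∀ q ∈ builtArea c n m k ω, 2 * d < |p 0 - q 0| + |p 1 - q 1| := fun q hq => by
      linarith [hfar q hq, dist_le_abs_add_abs p q]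
    obtain ⟨a, ha, ha0, ha1, l, hl, hpl⟩ := hwest p hp hpw
    -- It suffices that all vertices of the triangle around `p` have height 0. A vertex of height
    -- `h` would put `p` in a grid cell next to a farm, a widened road or the ridges; clamping the
    -- coordinates of `p` then gives a built point that is too close.
    refine hval a (by omega) l hl p hpl {0} (convex_singleton 0) fun v hv => ?_
    obtain ⟨hv0, hv1⟩ := htri a ha l v hv
    obtain ⟨hc1, hc2⟩ := hcell a ha l p hpl
    have hbelow : ∀ b, y b < v 1 → y b ≤ p 1 := by
      intro b hb
      refine le_trans (hy.monotone ?_) hc1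
      rcases hv1 with e | e <;> rw [e, hy.lt_iff_lt] at hb <;> omega
    have habove : ∀ b, v 1 < y b → p 1 ≤ y b := by
      intro b hb
      refine hc2.trans (hy.monotone ?_)
      rcases hv1 with e | e <;> rw [e, hy.lt_iff_lt] at hb <;> omega
    have m2 : S.X (a + 1) ≤ ridgesWest c n := hX4 ▸ hXm.monotone ha
    have m3 := S.X_lt a
    have hvw : v 0 ≤ ridgesWest c n := by rcases hv0 with e | e <;> linarith
    rcases hvw.eq_or_lt with e | hlt
    · exfalso
      have ha3 : 3 ≤ a := by
        rcases hv0 with e' | e' <;> rw [e', ← hX4, hXm.injective.eq_iff] at e <;> omega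
      have : ridgesWest c n - d ≤ p 0 := by
        rw [← hX3]; exact (hXm.monotone ha3).trans ha0
      have hin : pt (ridgesWest c n) (p 1) ∈ builtArea c n m k ω := by
        refine .inr ⟨pt_mem_unitSquare.2 ⟨⟨by linarith, ?_⟩, hp 1⟩, le_rfl⟩
        rw [ridgesWest]; linarith [ridgesWidth_pos hc n]
      have := hfar' _ hin
      simp only [pt_zero, pt_one, sub_self, abs_zero, add_zero] at this
      rw [abs_of_neg (by linarith)] at this
      linarith
    rw [Set.mem_singleton_iff, hf, vertexHeight, if_pos hlt, if_neg]
    rintro ⟨i, hi, ⟨hx, hv1l, hv1u⟩ | ⟨hx, hv1l, hv1u⟩⟩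
    · have ha1' : a ≤ 1 := by
        have := hx.2
        rcases hv0 with e | e <;> rw [e, ← hX1, hXm.le_iff_le] at this <;> omega
      have hp0 : p 0 ≤ farmSide c m + d := ha1.trans (hX2 ▸ hXm.monotone (by omega))
      obtain ⟨b₀, -, e₀⟩ := hlevel i hi (farmSouth c m i - d) (by simp)
      obtain ⟨b₃, -, e₃⟩ := hlevel i hi (farmSouth c m i + farmSide c m + d) (by simp)
      have hl1 : farmSouth c m i - d ≤ p 1 := e₀ ▸ hbelow b₀ (by rw [e₀]; linarith)
      have hl2 : p 1 ≤ farmSouth c m i + farmSide c m + d :=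
        e₃ ▸ habove b₃ (by rw [e₃]; linarith)
      have hin : pt (min (p 0) (farmSide c m))
          (max (farmSouth c m i) (min (p 1) (farmSouth c m i + farmSide c m)))
          ∈ builtArea c n m k ω := by
        refine .inl (Set.mem_iUnion₂.2 ⟨i, hi, .inl ⟨⟨?_, ?_⟩, ?_, ?_⟩⟩)
        · exact le_min (hp 0).1 hs.le
        · exact min_le_right _ _
        · exact le_max_left _ _
        · exact max_le (by linarith) (min_le_right _ _)
      have := hfar' _ hin
      simp only [pt_zero, pt_one] at this
      have b1 : |p 0 - min (p 0) (farmSide c m)| ≤ d := by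
        rw [abs_le]; constructor
        · linarith [min_le_left (p 0) (farmSide c m)]
        · rcases min_choice (p 0) (farmSide c m) with e | e <;> rw [e] <;> linarith
      have b2 : |p 1 - max (farmSouth c m i) (min (p 1) (farmSouth c m i + farmSide c m))|
          ≤ d := by
        rw [abs_le]; constructor
        · rcases max_choice (farmSouth c m i) (min (p 1) (farmSouth c m i + farmSide c m))
            with e | e <;> rw [e] <;>
            linarith [min_le_left (p 1) (farmSouth c m i + farmSide c m)]
        · rcases min_choice (p 1) (farmSouth c m i + farmSide c m) with e | e <;> rw [e]
          · linarith [le_max_right (farmSouth c m i) (p 1)]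
          · linarith [le_max_right (farmSouth c m i) (farmSouth c m i + farmSide c m)]
      linarith
    · obtain ⟨b₀, -, e₀⟩ := hlevel i hi (farmSouth c m i - d) (by simp)
      obtain ⟨b₃, -, e₃⟩ := hlevel i hi (farmSouth c m i + ω + 2 * d) (by simp)
      have hl1 : farmSouth c m i - d ≤ p 1 := e₀ ▸ hbelow b₀ (by rw [e₀]; linarith)
      have hl2 : p 1 ≤ farmSouth c m i + ω + 2 * d := e₃ ▸ habove b₃ (by rw [e₃]; linarith)
      rcases le_total (farmSide c m) (p 0) with hps | hps
      · have hin : pt (p 0) (max (farmSouth c m i) (min (p 1) (farmSouth c m i + ω)))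
            ∈ builtArea c n m k ω := by
          refine .inl (Set.mem_iUnion₂.2 ⟨i, hi, .inr ⟨⟨hps, hpw.le⟩, ?_, ?_⟩⟩)
          · exact le_max_left _ _
          · exact max_le (by linarith) (min_le_right _ _)
        have := hfar' _ hin
        simp only [pt_zero, pt_one, sub_self, abs_zero, zero_add] at this
        have b2 : |p 1 - max (farmSouth c m i) (min (p 1) (farmSouth c m i + ω))| ≤ 2 * d := by
          rw [abs_le]; constructor
          · rcases max_choice (farmSouth c m i) (min (p 1) (farmSouth c m i + ω))
              with e | e <;> rw [e] <;> linarith [min_le_left (p 1) (farmSouth c m i + ω)]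
          · rcases min_choice (p 1) (farmSouth c m i + ω) with e | e <;> rw [e]
            · linarith [le_max_right (farmSouth c m i) (p 1)]
            · linarith [le_max_right (farmSouth c m i) (farmSouth c m i + ω)]
        linarith
      · have hin : pt (p 0) (max (farmSouth c m i) (p 1)) ∈ builtArea c n m k ω := by
          refine .inl (Set.mem_iUnion₂.2 ⟨i, hi, .inl ⟨⟨(hp 0).1, hps⟩, ?_, ?_⟩⟩)
          · exact le_max_left _ _
          · exact max_le (by linarith) (by linarith)
        have := hfar' _ hin
        simp only [pt_zero, pt_one, sub_self, abs_zero, zero_add] at this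
        have b2 : |p 1 - max (farmSouth c m i) (p 1)| ≤ d := by
          rw [abs_le]; constructor
          · rcases max_choice (farmSouth c m i) (p 1) with e | e <;> rw [e] <;> linarith
          · linarith [le_max_right (farmSouth c m i) (p 1)]
        linarith
  · intro p hp hpb
    have hpw : p 0 < ridgesWest c n := by
      by_contra hcon
      exact hpb (.inr ⟨hp, not_lt.1 hcon⟩)
    obtain ⟨a, ha, ha0, ha1, l, hl, hpl⟩ := hwest p hp hpw
    refine hval a (by omega) l hl p hpl _ (convex_Icc 0 h) fun v hv => ?_
    have m2 : S.X (a + 1) ≤ ridgesWest c n := hX4 ▸ hXm.monotone ha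
    have m3 := S.X_lt a
    have hvw : v 0 ≤ ridgesWest c n := by
      rcases (htri a ha l v hv).1 with e | e <;> linarith
    rcases hvw.eq_or_lt with e | hlt
    · rw [hfw v e]; exact ⟨hh, le_rfl⟩
    · rw [hf, vertexHeight, if_pos hlt]
      split_ifs
      · exact ⟨hh, le_rfl⟩
      · exact ⟨le_rfl, hh⟩
  · rw [hT]
    -- Five columns carry all `N + 1` levels, the remaining `2 n` columns only two.
    let I : Finset (ℕ × ℕ) := Finset.range 5 ×ˢ Finset.range (N + 1)
      ∪ Finset.Ico 5 (5 + 2 * n) ×ˢ Finset.range 2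
    have hsub : S.complex.vertices ⊆ (I.image fun ab => pt (S.X ab.1) (S.Y ab.1 ab.2) :
        Finset Plane) := by
      intro v hv
      obtain ⟨a, ha, i, hi, hvi⟩ := S.exists_of_mem_vertices hv
      rw [hSn] at ha
      have hleneq : S.len a = if a < 4 then 2 * N else if a = 4 then N + 1 else 2 := rfl
      have hβ : S.β a i = if a = 4 then min i N else i / 2 := rfl
      have hδ : S.δ a i = if a = 4 then i - N else (i + 1) / 2 := rfl
      rw [hleneq] at hi
      rw [Finset.coe_image]
      rcases hvi with rfl | rfl
      · refine ⟨(a, S.β a i), ?_, rfl⟩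
        simp only [I, Finset.mem_coe, Finset.mem_union, Finset.mem_product, Finset.mem_range,
          Finset.mem_Ico, hβ]
        split_ifs at hi ⊢ <;> omega
      · refine ⟨(a + 1, S.δ a i), ?_, rfl⟩
        simp only [I, Finset.mem_coe, Finset.mem_union, Finset.mem_product, Finset.mem_range,
          Finset.mem_Ico, hδ]
        split_ifs at hi ⊢ <;> omega
    have hcard : I.card ≤ 5 * (N + 1) + 2 * n * 2 := by
      refine (Finset.card_union_le _ _).trans ?_
      simp [Finset.card_product]
    have h1 := Set.ncard_le_ncard hsub (Finset.finite_toSet _)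
    rw [Set.ncard_coe_finset] at h1
    have h2 := Finset.card_image_le (s := I) (f := fun ab => pt (S.X ab.1) (S.Y ab.1 ab.2))
    have h3 := card_levels_le c m k ω d
    omega

end Existence

/-! ### Path lengths, geodesic distances and the skeleton of a terrain. -/

namespace Terrain

variable (T : Terrain)

@[simp] theorem lift_zero (p : Plane) : T.lift p 0 = p 0 := rfl

@[simp] theorem lift_one (p : Plane) : T.lift p 1 = p 1 := rfl

@[simp] theorem lift_two (p : Plane) : T.lift p 2 = T.height p := rfl

theorem ofReal_abs_sub_le_edist_lift (p q : Plane) (i : Fin 3) :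
    ENNReal.ofReal |T.lift p i - T.lift q i| ≤ edist (T.lift p) (T.lift q) := by
  rw [edist_dist, dist_eq_norm]
  exact ENNReal.ofReal_le_ofReal (PiLp.norm_apply_le (T.lift p - T.lift q) i)

theorem edist_lift_le (p q : Plane) : edist (T.lift p) (T.lift q) ≤
    ENNReal.ofReal (|p 0 - q 0| + |p 1 - q 1| + |T.height p - T.height q|) := by
  rw [edist_dist]
  refine ENNReal.ofReal_le_ofReal ?_
  rw [EuclideanSpace.dist_eq, Fin.sum_univ_three]
  simp only [lift_zero, lift_one, lift_two, Real.dist_eq]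
  refine Real.sqrt_le_iff.2 ⟨by positivity, ?_⟩
  have h0 := abs_nonneg (p 0 - q 0)
  have h1 := abs_nonneg (p 1 - q 1)
  have h2 := abs_nonneg (T.height p - T.height q)
  nlinarith [mul_nonneg h0 h1, mul_nonneg h0 h2, mul_nonneg h1 h2]

theorem edist_lift_le_pathLength {p q : unitSquare} (γ : Path p q) (t u : unitInterval) :
    edist (T.lift (γ t)) (T.lift (γ u)) ≤ T.pathLength γ :=
  eVariationOn.edist_le (fun t => T.lift (γ t)) (Set.mem_univ t) (Set.mem_univ u)

theorem edist_lift_add_le_pathLength {p q : unitSquare} (γ : Path p q) (t : unitInterval) :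
    edist (T.lift p) (T.lift (γ t)) + edist (T.lift (γ t)) (T.lift q) ≤ T.pathLength γ := by
  have h := eVariationOn.add_le_union (fun t => T.lift (γ t)) (s := Set.Iic t) (t := Set.Ici t)
    fun x hx y hy => le_trans hx hy
  have h1 := eVariationOn.edist_le (fun t => T.lift (γ t)) (s := Set.Iic t) (x := 0) (y := t)
    (Set.mem_Iic.2 unitInterval.nonneg') (Set.mem_Iic.2 le_rfl)
  have h2 := eVariationOn.edist_le (fun t => T.lift (γ t)) (s := Set.Ici t) (x := t) (y := 1)
    (Set.mem_Ici.2 le_rfl) (Set.mem_Ici.2 unitInterval.le_one')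
  simp only [γ.source, γ.target] at h1 h2
  exact (add_le_add h1 h2).trans (h.trans (eVariationOn.mono _ (Set.subset_univ _)))

/-- The variation splits at time 1/2, and each half is a monotone reparametrization of one of the
two paths. -/
theorem pathLength_trans_le {p q r : unitSquare} (γ : Path p q) (γ' : Path q r) :
    T.pathLength (γ.trans γ') ≤ T.pathLength γ + T.pathLength γ' := by
  let o : unitInterval := ⟨1 / 2, by norm_num, by norm_num⟩
  have hu : (Set.univ : Set unitInterval) = Set.Iic o ∪ Set.Ici o := Set.Iic_union_Ici.symm
  have hφ : Monotone fun t : unitInterval => Set.projIcc (0 : ℝ) 1 zero_le_one (2 * t) :=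
    fun a b h => Set.monotone_projIcc _ (by
      have : (a : ℝ) ≤ b := h
      linarith)
  have hψ : Monotone fun t : unitInterval => Set.projIcc (0 : ℝ) 1 zero_le_one (2 * t - 1) :=
    fun a b h => Set.monotone_projIcc _ (by
      have : (a : ℝ) ≤ b := h
      linarith)
  unfold pathLength
  conv_lhs => rw [hu, eVariationOn.union _ isGreatest_Iic isLeast_Ici]
  refine add_le_add ?_ ?_
  · refine le_trans (le_of_eq (eVariationOn.eq_of_eqOn ?_))
      (eVariationOn.comp_le_of_monotoneOn (fun t => T.lift (γ t)) _ (hφ.monotoneOn _)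
        (Set.mapsTo_univ _ _))
    intro t ht
    have ht' : (t : ℝ) ≤ 1 / 2 := ht
    simp only [Function.comp, Path.trans_apply, ht', dif_pos]
    rw [Set.projIcc_of_mem zero_le_one ⟨by linarith [t.2.1], by linarith⟩]
  · refine le_trans (le_of_eq (eVariationOn.eq_of_eqOn ?_))
      (eVariationOn.comp_le_of_monotoneOn (fun t => T.lift (γ' t)) _ (hψ.monotoneOn _)
        (Set.mapsTo_univ _ _))
    intro t ht
    have ht' : 1 / 2 ≤ (t : ℝ) := ht
    simp only [Function.comp, Path.trans_apply]
    rw [Set.projIcc_of_mem zero_le_one ⟨by linarith, by linarith [t.2.2]⟩]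
    split_ifs with h
    · have : (t : ℝ) = 1 / 2 := le_antisymm h ht'
      have e1 : (⟨2 * (t : ℝ), by rw [this]; norm_num, by rw [this]; norm_num⟩ : unitInterval)
          = 1 := Subtype.ext (show 2 * (t : ℝ) = 1 by rw [this]; norm_num)
      have e2 : (⟨2 * (t : ℝ) - 1, by rw [this]; norm_num, by rw [this]; norm_num⟩ :
          unitInterval) = 0 := Subtype.ext (show 2 * (t : ℝ) - 1 = 0 by rw [this]; norm_num)
      rw [e1, e2, γ.target, γ'.source]
    · rfl

theorem geoDist_triangle (p q r : unitSquare) :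
    T.geoDist p r ≤ T.geoDist p q + T.geoDist q r := by
  refine ENNReal.le_iInf_add_iInf fun γ γ' => ?_
  exact (iInf_le _ (γ.trans γ')).trans (T.pathLength_trans_le γ γ')

/-- If the height is affine on a segment, the lift of the segment is straight. -/
theorem geoDist_le_edist_lift (p q : unitSquare) (A : Plane →ᵃ[ℝ] ℝ)
    (hA : ∀ r ∈ segment ℝ (p : Plane) q, T.height r = A r) :
    T.geoDist p q ≤ edist (T.lift p) (T.lift q) := by
  have hmem : ∀ t : unitInterval, AffineMap.lineMap (p : Plane) (q : Plane) (t : ℝ)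
      ∈ segment ℝ (p : Plane) q := fun t => by
    rw [segment_eq_image_lineMap]; exact ⟨t, t.2, rfl⟩
  let γ : Path p q :=
    { toFun := fun t => ⟨AffineMap.lineMap (p : Plane) (q : Plane) (t : ℝ),
        convex_unitSquare.segment_subset p.2 q.2 (hmem t)⟩
      continuous_toFun := by
        refine Continuous.subtype_mk ?_ _
        simp only [AffineMap.lineMap_apply_module]
        fun_prop
      source' := by simp
      target' := by simp }
  refine (iInf_le _ γ).trans ?_
  let g : ℝ → EuclideanSpace ℝ (Fin 3) := AffineMap.lineMap (T.lift p) (T.lift q)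
  have hg : LipschitzWith (nndist (T.lift p) (T.lift q)) g := lipschitzWith_lineMap _ _
  have hfun : (fun t => T.lift (γ t)) = g ∘ ((↑) : unitInterval → ℝ) := by
    funext t
    have hγ : ((γ t : unitSquare) : Plane) = AffineMap.lineMap (p : Plane) (q : Plane) (t : ℝ) :=
      rfl
    have hh : T.height (γ t) = (1 - (t : ℝ)) * T.height p + t * T.height q := by
      rw [hγ, hA _ (hmem t), hA _ (left_mem_segment _ _ _), hA _ (right_mem_segment _ _ _),
        AffineMap.apply_lineMap, AffineMap.lineMap_apply_module]
      simp
    ext i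
    simp only [Function.comp, g, AffineMap.lineMap_apply_module]
    fin_cases i
    · simp [hγ, AffineMap.lineMap_apply_module]
    · simp [hγ, AffineMap.lineMap_apply_module]
    · simp [hh]
  unfold pathLength
  rw [hfun]
  have hvar : eVariationOn ((↑) : unitInterval → ℝ) Set.univ ≤ 1 := by
    have hm : MonotoneOn ((↑) : unitInterval → ℝ) Set.univ := fun _ _ _ _ h => h
    have := hm.eVariationOn_eq (Set.mem_univ 0) (Set.mem_univ 1)
    rw [show (Set.univ ∩ Set.Icc (0 : unitInterval) 1) = Set.univ by
      ext t; simp [unitInterval.le_one']] at this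
    rw [this]; simp
  calc eVariationOn (g ∘ ((↑) : unitInterval → ℝ)) Set.univ
      ≤ nndist (T.lift p) (T.lift q) * eVariationOn ((↑) : unitInterval → ℝ) Set.univ :=
        (hg.lipschitzOnWith (s := Set.univ)).comp_eVariationOn_le (Set.mapsTo_univ _ _)
    _ ≤ nndist (T.lift p) (T.lift q) * 1 := by gcongr
    _ = edist (T.lift p) (T.lift q) := by rw [mul_one, edist_nndist]

/-- Off the skeleton the height is affine near the point, along every line. -/
theorem exists_affine_of_notMem_skeleton {z : unitSquare} (hz : z ∉ T.skeleton) (v : Plane) :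
    ∃ r > 0, ∃ A : Plane →ᵃ[ℝ] ℝ, ∀ t : ℝ, |t| ≤ r →
      T.height ((z : Plane) + t • v) = A ((z : Plane) + t • v) := by
  classical
  have hzs : (z : Plane) ∈ T.triangulation.space := by rw [T.space_eq]; exact z.2
  obtain ⟨s, hs, hzs⟩ := Geometry.SimplicialComplex.mem_space_iff.1 hzs
  have hi := T.triangulation.indep hs
  have hcard3 : s.card ≤ 3 := by
    have := hi.card_le_finrank_succ
    rw [Fintype.card_coe] at this
    refine this.trans (Nat.succ_le_succ ?_)
    refine (Submodule.finrank_le _).trans ?_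
    simp
  -- Faces in the plane have at most three vertices, and those with fewer belong to the skeleton.
  have hcard : s.card = 3 := by
    by_contra h
    exact hz ⟨s, hs, by omega, hzs⟩
  have htop : affineSpan ℝ (Set.range ((↑) : s → Plane)) = ⊤ :=
    hi.affineSpan_eq_top_iff_card_eq_finrank_add_one.2 (by simp [hcard])
  let b : AffineBasis s ℝ Plane := ⟨(↑), hi, htop⟩
  have hrange : Set.range b = (s : Set Plane) := Subtype.range_coe
  -- A vanishing barycentric coordinate would place the point on an edge of the triangle. Hence it
  -- is an interior point.
  have hpos : ∀ i, 0 < b.coord i z := by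
    intro i
    have hnn : ∀ i, 0 ≤ b.coord i z := by
      have := b.convexHull_eq_nonneg_coord
      rw [hrange] at this
      rw [this] at hzs
      exact hzs
    refine lt_of_le_of_ne (hnn i) fun h0 => hz ?_
    have hmem : (z : Plane) ∈ convexHull ℝ ((s.erase i : Finset Plane) : Set Plane) := by
      have hsum := b.linear_combination_coord_eq_self (z : Plane)
      have hone := b.sum_coord_apply_eq_one (z : Plane)
      rw [← Finset.add_sum_erase _ _ (Finset.mem_univ i), ← h0, zero_smul, zero_add] at hsum
      rw [← Finset.add_sum_erase _ _ (Finset.mem_univ i), ← h0, zero_add] at hone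
      rw [← hsum]
      refine (convex_convexHull ℝ _).sum_mem (fun j _ => hnn j) hone fun j hj => ?_
      refine subset_convexHull ℝ _ ?_
      rw [Finset.mem_coe, Finset.mem_erase]
      exact ⟨fun h => (Finset.mem_erase.1 hj).1 (Subtype.ext h), j.2⟩
    have hne : (s.erase i).Nonempty := by
      rw [← Finset.coe_nonempty]
      exact convexHull_nonempty_iff.1 ⟨_, hmem⟩
    exact ⟨s.erase i, T.triangulation.down_closed hs (Finset.erase_subset _ _) hne,
      by rw [Finset.card_erase_of_mem i.2, hcard], hmem⟩
  have hzint : (z : Plane) ∈ interior (convexHull ℝ (s : Set Plane)) := by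
    rw [← hrange, b.interior_convexHull]; exact hpos
  have hopen : IsOpen {t : ℝ | (z : Plane) + t • v ∈ interior (convexHull ℝ (s : Set Plane))} :=
    isOpen_interior.preimage (by fun_prop)
  obtain ⟨r, hr, hball⟩ := Metric.isOpen_iff.1 hopen 0 (by simpa using hzint)
  obtain ⟨A, hA⟩ := T.affine_on_faces s hs
  refine ⟨r / 2, by positivity, A, fun t ht => hA (interior_subset (hball ?_))⟩
  rw [Metric.mem_ball, Real.dist_eq, sub_zero]
  linarith

variable {m : ℕ} (P : Fin m → unitSquare)

/-- Every point of the skeleton in at least two cells contributes to the complexity. -/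
theorem encard_le_voronoiComplexity :
    {z | z ∈ T.skeleton ∧ 2 ≤ (T.incident P z).encard}.encard ≤ T.voronoiComplexity P := by
  have hsub : {z | z ∈ T.skeleton ∧ 2 ≤ (T.incident P z).encard} ⊆
      (T.voronoiVertices P ∪ T.breakpoints P) ∪ (T.chordPoints P ∩ T.skeleton) := by
    rintro z ⟨hz, h2⟩
    rcases h2.eq_or_lt with h | h
    · by_cases hb : z ∈ T.breakpoints P
      · exact .inl (.inr hb)
      · exact .inr ⟨⟨h.symm, hb⟩, hz⟩
    · refine .inl (.inl ?_)
      exact Order.add_one_le_of_lt h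
  refine (Set.encard_le_encard hsub).trans ((Set.encard_union_le _ _).trans ?_)
  exact add_le_add (Set.encard_union_le _ _) le_rfl

end Terrain

/-! ### Distances from the ridge lines to the farms. -/

theorem apply_mem_uIcc_of_mem_segment {p q r : Plane} (hr : r ∈ segment ℝ p q) (i : Fin 2) :
    r i ∈ Set.uIcc (p i) (q i) := by
  obtain ⟨a, b, ha, hb, hab, rfl⟩ := hr
  rw [← segment_eq_uIcc]
  exact ⟨a, b, ha, hb, hab, by simp⟩

/-- The parameters of a farming terrain on which every farm dominates near the end of its road. -/
structure Admissible (c : ℝ) (n m k : ℕ) (ω ε h : ℝ) : Prop where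
  c_pos : 0 < c
  one_le_n : 1 ≤ n
  side_pos : 0 < farmSide c m
  fit : 3 * k * farmSide c m ≤ 1
  ω_nonneg : 0 ≤ ω
  ε_pos : 0 < ε
  -- Equivalent to `2W + w + s < w + 2s - 3ε - ω`: the upper bound for the own farm is below the
  -- lower bound for any other farm.
  small : 2 * ridgesWidth c n + 3 * ε + ω < farmSide c m
  gap : farmSide c m + 3 * ε < ridgesWest c n
  high : 4 ≤ h

/-- The integer factor makes the spacing usable: a nonzero integer is at most -1 or at least 1, so
different farms are at least three sides apart in latitude. -/
theorem farmSouth_sub_farmSouth (c : ℝ) (m i j : ℕ) :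
    farmSouth c m i - farmSouth c m j = 3 * (((j : ℤ) - i : ℤ) : ℝ) * farmSide c m := by
  simp only [farmSouth]; push_cast; ring

theorem ridgeLine_mem_Icc {c : ℝ} {n j : ℕ} (hc : 0 < c) (hn : 1 ≤ n)
    (hw : 0 ≤ ridgesWest c n) (hj : j ≤ 2 * n) : ridgeLine c n j ∈ Set.Icc (0 : ℝ) 1 := by
  have hm := (ridgeLine_strictMono hc hn).monotone
  refine ⟨?_, ?_⟩
  · exact hw.trans ((ridgeLine_zero c n).symm.le.trans (hm (Nat.zero_le j)))
  · exact (hm hj).trans (ridgeLine_last c hn).le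

namespace IsFarmingTerrain

variable {T : Terrain} {c : ℝ} {n m k : ℕ} {ω ε h : ℝ}

theorem height_even (hT : IsFarmingTerrain T c n m k ω ε h) (hc : 0 < c) (hn : 1 ≤ n) {j : ℕ}
    (hj : j < 2 * n) (he : Even j) {p : Plane} (hp : p ∈ unitSquare) (hpj : p 0 = ridgeLine c n j) :
    T.height p = h := by
  have hlt := ridgeLine_strictMono hc hn (Nat.lt_succ_self j)
  rw [hT.height_ridge_up j hj he p hp (by rw [hpj]; exact ⟨le_rfl, hlt.le⟩), hpj]
  ring

theorem height_odd (hT : IsFarmingTerrain T c n m k ω ε h) (hc : 0 < c) (hn : 1 ≤ n) {j : ℕ}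
    (hj : j < 2 * n) (ho : Odd j) {p : Plane} (hp : p ∈ unitSquare) (hpj : p 0 = ridgeLine c n j) :
    T.height p = h + ridgesWidth c n / (2 * n) := by
  have hlt := ridgeLine_strictMono hc hn (Nat.lt_succ_self j)
  rw [hT.height_ridge_down j hj ho p hp (by rw [hpj]; exact ⟨le_rfl, hlt.le⟩), hpj,
    ridgeLine_succ]
  ring

theorem le_height_of_ridgeLine (hT : IsFarmingTerrain T c n m k ω ε h) (hc : 0 < c) (hn : 1 ≤ n)
    {j : ℕ} (hj : j < 2 * n) {p : Plane} (hp : p ∈ unitSquare) (hpj : p 0 = ridgeLine c n j) :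
    h ≤ T.height p := by
  rcases Nat.even_or_odd j with he | ho
  · exact (hT.height_even hc hn hj he hp hpj).ge
  · rw [hT.height_odd hc hn hj ho hp hpj]
    have := (ridgesWidth_pos hc n).le
    have : 0 ≤ ridgesWidth c n / (2 * n) := by positivity
    linarith

/-- A ridge line is level, so the segment along it lifts to a segment of the same length. This also
makes geodesic distances Lipschitz along ridge lines. -/
theorem geoDist_same_ridgeLine (hT : IsFarmingTerrain T c n m k ω ε h) (hc : 0 < c) (hn : 1 ≤ n)
    {j : ℕ} (hj : j < 2 * n) {z z' : unitSquare} (hz : (z : Plane) 0 = ridgeLine c n j)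
    (hz' : (z' : Plane) 0 = ridgeLine c n j) :
    T.geoDist z z' ≤ ENNReal.ofReal |(z : Plane) 1 - (z' : Plane) 1| := by
  have hconst : ∃ H : ℝ, ∀ p ∈ unitSquare, p 0 = ridgeLine c n j → T.height p = H := by
    rcases Nat.even_or_odd j with he | ho
    · exact ⟨_, fun p hp => hT.height_even hc hn hj he hp⟩
    · exact ⟨_, fun p hp => hT.height_odd hc hn hj ho hp⟩
  obtain ⟨H, hH⟩ := hconst
  refine (T.geoDist_le_edist_lift z z' (affineFn 0 0 H) fun r hr => ?_).trans
    ((T.edist_lift_le z z').trans ?_)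
  · have := apply_mem_uIcc_of_mem_segment hr 0
    rw [hz, hz', Set.uIcc_self] at this
    rw [hH r (convex_unitSquare.segment_subset z.2 z'.2 hr) this]
    simp
  · rw [hH z z.2 hz, hH z' z'.2 hz', hz, hz']
    simp

/-- Width plus height difference is used instead of the exact factor `√2`; the loss is harmless
since the ridges are exponentially narrow. -/
theorem geoDist_succ_ridgeLine (hT : IsFarmingTerrain T c n m k ω ε h) (hc : 0 < c) (hn : 1 ≤ n)
    {j : ℕ} (hj : j < 2 * n) {z z' : unitSquare} (hz : (z : Plane) 0 = ridgeLine c n (j + 1))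
    (hz' : (z' : Plane) 0 = ridgeLine c n j) (hy : (z : Plane) 1 = (z' : Plane) 1) :
    T.geoDist z z' ≤ ENNReal.ofReal (2 * (ridgesWidth c n / (2 * n))) := by
  have hlt := ridgeLine_strictMono hc hn (Nat.lt_succ_self j)
  have hpos : 0 ≤ ridgesWidth c n / (2 * n) := by
    have := ridgesWidth_pos hc n
    positivity
  have haff : ∃ (σ e : ℝ), |σ| = 1 ∧ ∀ p ∈ unitSquare,
      p 0 ∈ Set.Icc (ridgeLine c n j) (ridgeLine c n (j + 1)) → T.height p = σ * p 0 + e := by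
    rcases Nat.even_or_odd j with he | ho
    · refine ⟨1, h - ridgeLine c n j, abs_one, fun p hp hpj => ?_⟩
      rw [hT.height_ridge_up j hj he p hp hpj]; ring
    · refine ⟨-1, h + ridgeLine c n (j + 1), by simp, fun p hp hpj => ?_⟩
      rw [hT.height_ridge_down j hj ho p hp hpj]; ring
  obtain ⟨σ, e, hσ, hH⟩ := haff
  have hIcc : ∀ r ∈ segment ℝ (z : Plane) z',
      r 0 ∈ Set.Icc (ridgeLine c n j) (ridgeLine c n (j + 1)) := fun r hr => by
    have := apply_mem_uIcc_of_mem_segment hr 0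
    rwa [hz, hz', Set.uIcc_comm, Set.uIcc_of_le hlt.le] at this
  refine (T.geoDist_le_edist_lift z z' (affineFn σ 0 e) fun r hr => ?_).trans
    ((T.edist_lift_le z z').trans (ENNReal.ofReal_le_ofReal ?_))
  · rw [hH r (convex_unitSquare.segment_subset z.2 z'.2 hr) (hIcc r hr)]
    simp
  · rw [hH z z.2 (hIcc _ (left_mem_segment _ _ _)), hH z' z'.2 (hIcc _ (right_mem_segment _ _ _)),
      hy, hz, hz', sub_self, abs_zero, ridgeLine_succ,
      show σ * (ridgeLine c n j + ridgesWidth c n / (2 * n)) + e - (σ * ridgeLine c n j + e)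
        = σ * (ridgesWidth c n / (2 * n)) by ring, abs_mul, hσ,
      add_sub_cancel_left, abs_of_nonneg hpos]
    linarith

theorem geoDist_ridgesWest_le (hT : IsFarmingTerrain T c n m k ω ε h) (hc : 0 < c) (hn : 1 ≤ n)
    (hw : 0 ≤ ridgesWest c n) {j : ℕ} (hj : j ≤ 2 * n) {z z' : unitSquare}
    (hz : (z : Plane) 0 = ridgeLine c n j) (hz' : (z' : Plane) 0 = ridgesWest c n)
    (hy : (z : Plane) 1 = (z' : Plane) 1) :
    T.geoDist z z' ≤ ENNReal.ofReal (j * (2 * (ridgesWidth c n / (2 * n)))) := by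
  have hpos : 0 ≤ ridgesWidth c n / (2 * n) := by
    have := ridgesWidth_pos hc n
    positivity
  induction j generalizing z with
  | zero =>
    rw [← ridgeLine_zero] at hz'
    have := hT.geoDist_same_ridgeLine hc hn (j := 0) (by omega) hz hz'
    rw [hy, sub_self, abs_zero] at this
    simpa using this
  | succ j ih =>
    let u : unitSquare := ⟨pt (ridgeLine c n j) ((z : Plane) 1), pt_mem_unitSquare.2
      ⟨ridgeLine_mem_Icc hc hn hw (by omega), z.2 1⟩⟩
    refine (T.geoDist_triangle z u z').trans ?_
    have h1 := hT.geoDist_succ_ridgeLine hc hn (j := j) (by omega) hz (z' := u) rfl rfl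
    have h2 := ih (by omega) (z := u) rfl hy
    refine (add_le_add h1 h2).trans ?_
    rw [← ENNReal.ofReal_add (by positivity) (by positivity)]
    refine ENNReal.ofReal_le_ofReal ?_
    push_cast
    linarith

/-- A site in a farm is close to the points of the ridges at the end of the road. -/
theorem geoDist_le_of_mem_farm (hT : IsFarmingTerrain T c n m k ω ε h)
    (hA : Admissible c n m k ω ε h) {i : ℕ} (hi : i < k) {j : ℕ} (hj : j ≤ 2 * n)
    {z q : unitSquare} (hz : (z : Plane) 0 = ridgeLine c n j)
    (hzi : (z : Plane) 1 = farmSouth c m i) (hq : (q : Plane) ∈ farm c m i) :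
    T.geoDist z q ≤ ENNReal.ofReal
      (2 * ridgesWidth c n + ridgesWest c n + farmSide c m) := by
  have hn0 : (0 : ℝ) < n := by exact_mod_cast hA.one_le_n
  have hW := ridgesWidth_pos hA.c_pos n
  have hs := hA.side_pos
  have hg := hA.gap
  have hε := hA.ε_pos
  have hω := hA.ω_nonneg
  obtain ⟨hb1, hb2⟩ := farmSouth_bounds hs hA.fit hi
  have hw1 : ridgesWest c n ≤ 1 := by rw [ridgesWest]; linarith
  have hyi : farmSouth c m i ∈ Set.Icc (0 : ℝ) 1 := ⟨by linarith, by linarith⟩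
  -- The route passes the eastern end `u` of the road and the south-east corner `v` of the farm; its
  -- pieces are bounded by `2W`, `w - s` and `2s`.
  let u : unitSquare := ⟨pt (ridgesWest c n) (farmSouth c m i),
    pt_mem_unitSquare.2 ⟨⟨by linarith, hw1⟩, hyi⟩⟩
  let v : unitSquare := ⟨pt (farmSide c m) (farmSouth c m i),
    pt_mem_unitSquare.2 ⟨⟨by linarith, by linarith⟩, hyi⟩⟩
  have hu : T.height u = h := hT.height_farm_road i hi _
    (.inr ⟨⟨by simp [u]; linarith, le_rfl⟩, le_rfl, by simp [u, hω]⟩)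
  have hv : T.height v = h := hT.height_farm_road i hi _
    (.inl ⟨⟨by simp [v]; linarith, le_rfl⟩, le_rfl, by simp [v]; linarith⟩)
  have hqh : T.height q = h := hT.height_farm_road i hi _ (.inl hq)
  have h1 : T.geoDist z u ≤ ENNReal.ofReal (2 * ridgesWidth c n) := by
    refine (hT.geoDist_ridgesWest_le hA.c_pos hA.one_le_n (by linarith) hj hz (z' := u) rfl
      hzi).trans (ENNReal.ofReal_le_ofReal ?_)
    have : (j : ℝ) ≤ 2 * n := by exact_mod_cast hj
    calc (j : ℝ) * (2 * (ridgesWidth c n / (2 * n)))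
        ≤ 2 * n * (2 * (ridgesWidth c n / (2 * n))) := by gcongr
      _ = 2 * ridgesWidth c n := by field_simp
  have h2 : T.geoDist u v ≤ ENNReal.ofReal (ridgesWest c n - farmSide c m) := by
    refine (T.geoDist_le_edist_lift u v (affineFn 0 0 h) fun r hr => ?_).trans
      ((T.edist_lift_le u v).trans (ENNReal.ofReal_le_ofReal ?_))
    · have hr0 := apply_mem_uIcc_of_mem_segment hr 0
      have hr1 := apply_mem_uIcc_of_mem_segment hr 1
      simp only [u, v, pt_zero, pt_one, Set.uIcc_self, Set.mem_singleton_iff] at hr0 hr1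
      rw [Set.uIcc_comm, Set.uIcc_of_le (by linarith)] at hr0
      rw [hT.height_farm_road i hi r (.inr ⟨hr0, hr1.ge, by linarith⟩)]
      simp
    · rw [hu, hv]
      simp only [u, v, pt_zero, pt_one, sub_self, abs_zero, add_zero]
      rw [abs_of_nonneg (by linarith)]
  have h3 : T.geoDist v q ≤ ENNReal.ofReal (2 * farmSide c m) := by
    refine (T.geoDist_le_edist_lift v q (affineFn 0 0 h) fun r hr => ?_).trans
      ((T.edist_lift_le v q).trans (ENNReal.ofReal_le_ofReal ?_))
    · have hr0 := apply_mem_uIcc_of_mem_segment hr 0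
      have hr1 := apply_mem_uIcc_of_mem_segment hr 1
      simp only [v, pt_zero, pt_one] at hr0 hr1
      rw [Set.uIcc_comm, Set.uIcc_of_le hq.1.2] at hr0
      rw [Set.uIcc_of_le hq.2.1] at hr1
      rw [hT.height_farm_road i hi r (.inl ⟨⟨hq.1.1.trans hr0.1, hr0.2⟩,
        hr1.1, hr1.2.trans hq.2.2⟩)]
      simp
    · rw [hqh, hv]
      simp only [v, pt_zero, pt_one, sub_self, abs_zero, add_zero]
      have e1 := hq.1
      have e2 := hq.2
      rw [abs_of_nonneg (by linarith [e1.2]), abs_of_nonpos (by linarith [e2.1])]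
      linarith [e1.1, e2.2]
  calc T.geoDist z q ≤ T.geoDist z u + (T.geoDist u v + T.geoDist v q) :=
        (T.geoDist_triangle z u q).trans (add_le_add le_rfl (T.geoDist_triangle u v q))
    _ ≤ ENNReal.ofReal (2 * ridgesWidth c n) + (ENNReal.ofReal (ridgesWest c n - farmSide c m)
        + ENNReal.ofReal (2 * farmSide c m)) := add_le_add h1 (add_le_add h2 h3)
    _ = _ := by
      rw [← ENNReal.ofReal_add (by linarith) (by linarith),
        ← ENNReal.ofReal_add (by linarith) (by linarith)]
      congr 1; ring

/-- A path that descends to the forbidden area is long. -/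
theorem ofReal_le_pathLength (hT : IsFarmingTerrain T c n m k ω ε h) (hc : 0 < c) (hn : 1 ≤ n)
    {j : ℕ} (hj : j < 2 * n) {z q : unitSquare} (hz : (z : Plane) 0 = ridgeLine c n j)
    (γ : Path z q) {t : unitInterval} (ht : T.height (γ t) = 0) :
    ENNReal.ofReal h ≤ T.pathLength γ := by
  refine le_trans ?_ (T.edist_lift_le_pathLength γ 0 t)
  refine le_trans (ENNReal.ofReal_le_ofReal ?_) (T.ofReal_abs_sub_le_edist_lift _ _ 2)
  rw [T.lift_two, T.lift_two, ht, γ.source, sub_zero]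
  exact (hT.le_height_of_ridgeLine hc hn hj z.2 hz).trans (le_abs_self _)

/-- Contrapositive of `height_forbidden`, with the distance bounding each coordinate. It confines
paths that never reach height 0 to a neighbourhood of the built area. -/
theorem exists_near_of_height_ne_zero (hT : IsFarmingTerrain T c n m k ω ε h) {p : Plane}
    (hp : p ∈ unitSquare) (h0 : T.height p ≠ 0) :
    ∃ q ∈ builtArea c n m k ω, |p 0 - q 0| < ε ∧ |p 1 - q 1| < ε := by
  by_contra! hcon
  refine h0 (hT.height_forbidden p hp fun q hq => ?_)
  have hc' : ∀ i, |p i - q i| ≤ dist p q := fun i => by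
    rw [dist_eq_norm]; exact PiLp.norm_apply_le (p - q) i
  by_contra! hlt
  exact absurd (hcon q hq ((hc' 0).trans_lt hlt)) (not_le.2 ((hc' 1).trans_lt hlt))

/-- A path from the ridges at the end of the road of one farm to another farm has to take the
road of that farm. -/
theorem le_pathLength_of_mem_farm (hT : IsFarmingTerrain T c n m k ω ε h)
    (hA : Admissible c n m k ω ε h) {i l : ℕ} (hil : i ≠ l) {j : ℕ}
    {z q : unitSquare} (hz : (z : Plane) 0 = ridgeLine c n j)
    (hzi : (z : Plane) 1 = farmSouth c m i) (hq : (q : Plane) ∈ farm c m l) (γ : Path z q)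
    (hγ : ∀ t, T.height (γ t) ≠ 0) :
    ENNReal.ofReal (ridgesWest c n + 2 * farmSide c m - 3 * ε - ω) ≤ T.pathLength γ := by
  have hW := ridgesWidth_pos hA.c_pos n
  have hs := hA.side_pos
  have hg := hA.gap
  have hε := hA.ε_pos
  have hω := hA.ω_nonneg
  have hsm := hA.small
  have hcont : ∀ i, Continuous fun t => (γ t : Plane) i := fun i => by
    have : Continuous fun p : Plane => p i := by fun_prop
    exact this.comp (continuous_subtype_val.comp γ.continuous)
  have hzw : ridgesWest c n ≤ (z : Plane) 0 := by
    rw [hz, ← ridgeLine_zero]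
    exact (ridgeLine_strictMono hA.c_pos hA.one_le_n).monotone (Nat.zero_le j)
  -- the last time at which the path leaves the neighbourhood of the ridges
  obtain ⟨τ, hτ, hτmax⟩ : ∃ τ, IsGreatest {t | ridgesWest c n - 2 * ε ≤ (γ t : Plane) 0} τ := by
    refine IsCompact.exists_isGreatest ?_ ⟨0, ?_⟩
    · exact (isClosed_le continuous_const (hcont 0)).isCompact
    · simp only [Set.mem_ofPred_eq, γ.source]; linarith
  obtain ⟨σ, hσ, hσx⟩ : ∃ σ ∈ Set.Ici τ, (γ σ : Plane) 0 = ridgesWest c n - 2 * ε := by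
    have := isPreconnected_Ici.intermediate_value (a := 1) (b := τ) (s := Set.Ici τ)
      (Set.mem_Ici.2 unitInterval.le_one') (Set.mem_Ici.2 le_rfl) (hcont 0).continuousOn
    refine this ⟨?_, hτ⟩
    rw [γ.target]
    linarith [hq.1.2]
  have hσle : ∀ t ∈ Set.Ici σ, (γ t : Plane) 0 ≤ ridgesWest c n - 2 * ε := by
    intro t ht
    by_contra! hcon
    have h1 : t ≤ τ := hτmax hcon.le
    have h2 : t = σ := le_antisymm (h1.trans hσ) ht
    rw [h2, hσx] at hcon
    exact lt_irrefl _ hcon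
  have hnear : ∀ t ∈ Set.Ici σ, ∃ b < k, ∃ r ∈ farm c m b ∪ road c n m ω b,
      |(γ t : Plane) 0 - r 0| < ε ∧ |(γ t : Plane) 1 - r 1| < ε := by
    intro t ht
    obtain ⟨r, hr | hr, h0, h1⟩ := hT.exists_near_of_height_ne_zero (γ t).2 (hγ t)
    · obtain ⟨b, hb, hr⟩ := Set.mem_iUnion₂.1 hr
      exact ⟨b, hb, r, hr, h0, h1⟩
    · have := hr.2
      have := hσle t ht
      rw [abs_lt] at h0
      linarith [h0.1]
  -- After time `σ` the path is within `ε` of farms and roads. These two latitudes, halfway between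
  -- neighbouring farms, are at distance at least `s > ε` from all of them, so they act as barriers.
  have hlevel : ∀ t ∈ Set.Ici σ, (γ t : Plane) 1 ≠ farmSouth c m l - farmSide c m ∧
      (γ t : Plane) 1 ≠ farmSouth c m l + 2 * farmSide c m := by
    intro t ht
    obtain ⟨b, -, r, hr, -, h1⟩ := hnear t ht
    have hr1 : farmSouth c m b ≤ r 1 ∧ r 1 ≤ farmSouth c m b + farmSide c m := by
      rcases hr with hr | hr
      · exact hr.2
      · exact ⟨hr.2.1, hr.2.2.trans (by linarith)⟩
    have hd := farmSouth_sub_farmSouth c m l b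
    generalize ((b : ℤ) - l : ℤ) = x at hd
    rw [abs_lt] at h1
    constructor
    · intro e
      rcases le_or_gt x 0 with hx | hx
      · have : (x : ℝ) ≤ 0 := by exact_mod_cast hx
        nlinarith [h1.1]
      · have : (1 : ℝ) ≤ x := by exact_mod_cast hx
        nlinarith [h1.2]
    · intro e
      rcases le_or_gt x (-1) with hx | hx
      · have : (x : ℝ) ≤ -1 := by exact_mod_cast hx
        nlinarith [h1.1]
      · have : (0 : ℝ) ≤ x := by exact_mod_cast (show 0 ≤ x by omega)
        nlinarith [h1.2]
  have hpre : IsPreconnected (Set.Ici σ) := isPreconnected_Ici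
  have h1mem : (1 : unitInterval) ∈ Set.Ici σ := Set.mem_Ici.2 unitInterval.le_one'
  have hσmem : σ ∈ Set.Ici σ := Set.mem_Ici.2 le_rfl
  have hq1 : (γ 1 : Plane) 1 = (q : Plane) 1 := by rw [γ.target]
  have hlo : farmSouth c m l - farmSide c m < (γ σ : Plane) 1 := by
    by_contra! hcon
    obtain ⟨t, ht, e⟩ := hpre.intermediate_value hσmem h1mem (hcont 1).continuousOn
      ⟨hcon, by rw [hq1]; linarith [hq.2.1]⟩
    exact (hlevel t ht).1 e
  have hhi : (γ σ : Plane) 1 < farmSouth c m l + 2 * farmSide c m := by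
    by_contra! hcon
    obtain ⟨t, ht, e⟩ := hpre.intermediate_value h1mem hσmem (hcont 1).continuousOn
      ⟨by rw [hq1]; linarith [hq.2.2], hcon⟩
    exact (hlevel t ht).2 e
  -- At time `σ` the path is too far east to be near a farm, so it is near a road; the barriers
  -- leave only the road of farm `l`.
  have hroad : farmSouth c m l - ε < (γ σ : Plane) 1 ∧
      (γ σ : Plane) 1 < farmSouth c m l + ω + ε := by
    obtain ⟨b, -, r, hr | hr, h0, h1⟩ := hnear σ hσmem
    · rw [hσx, abs_lt] at h0
      linarith [h0.2, hr.1.2]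
    · have hr1 := hr.2
      rw [abs_lt] at h1
      have hd := farmSouth_sub_farmSouth c m l b
      have hbl : b = l := by
        have : ((b : ℤ) - l : ℤ) = 0 := by
          generalize ((b : ℤ) - l : ℤ) = x at hd
          by_contra hx
          rcases lt_or_gt_of_ne hx with hx | hx
          · have : (x : ℝ) ≤ -1 := by exact_mod_cast (show x ≤ -1 by omega)
            nlinarith [h1.1, hr1.1]
          · have : (1 : ℝ) ≤ x := by exact_mod_cast hx
            nlinarith [h1.2, hr1.2]
        omega
      subst hbl
      exact ⟨by linarith [h1.1, hr1.1], by linarith [h1.2, hr1.2]⟩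
  have hdy : 3 * farmSide c m - ω - ε ≤ |(z : Plane) 1 - (γ σ : Plane) 1| := by
    have hd := farmSouth_sub_farmSouth c m i l
    have hx : ((l : ℤ) - i : ℤ) ≠ 0 := by omega
    generalize ((l : ℤ) - i : ℤ) = x at hd hx
    rw [hzi, le_abs]
    rcases lt_or_gt_of_ne hx with hx | hx
    · have : (x : ℝ) ≤ -1 := by exact_mod_cast (show x ≤ -1 by omega)
      right
      nlinarith [hroad.1]
    · have : (1 : ℝ) ≤ x := by exact_mod_cast hx
      left
      nlinarith [hroad.2]
  have hdx : ridgesWest c n - 2 * ε - farmSide c m ≤ |(γ σ : Plane) 0 - (q : Plane) 0| := by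
    rw [hσx]
    exact le_trans (by linarith [hq.1.2]) (le_abs_self _)
  -- The path is cut at `σ`: latitude is counted before, longitude after.
  refine le_trans ?_ (T.edist_lift_add_le_pathLength γ σ)
  refine le_trans ?_ (add_le_add (T.ofReal_abs_sub_le_edist_lift _ _ 1)
    (T.ofReal_abs_sub_le_edist_lift _ _ 0))
  rw [← ENNReal.ofReal_add (abs_nonneg _) (abs_nonneg _)]
  refine ENNReal.ofReal_le_ofReal ?_
  simp only [T.lift_one, T.lift_zero]
  linarith

/-- At the end of the road of a farm with a site, the nearest sites belong to that farm. -/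
theorem mem_farm_of_mem_cell (hT : IsFarmingTerrain T c n m k ω ε h)
    (hA : Admissible c n m k ω ε h) {M : ℕ} {P : Fin M → unitSquare}
    (hP : ∀ a, T.height (P a) = 0 ∨ ∃ l < k, (P a : Plane) ∈ farm c m l) {i : ℕ} (hi : i < k)
    (hocc : ∃ a, (P a : Plane) ∈ farm c m i) {j : ℕ} (hj : j < 2 * n) {z : unitSquare}
    (hz : (z : Plane) 0 = ridgeLine c n j) (hzi : (z : Plane) 1 = farmSouth c m i) {a : Fin M}
    (ha : z ∈ T.cell P a) : (P a : Plane) ∈ farm c m i := by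
  have hW := ridgesWidth_pos hA.c_pos n
  have hs := hA.side_pos
  have hg := hA.gap
  have hε := hA.ε_pos
  have hω := hA.ω_nonneg
  have hsm := hA.small
  have hh := hA.high
  by_contra hcon
  obtain ⟨b, hb⟩ := hocc
  have hle := (ha b).trans (hT.geoDist_le_of_mem_farm hA hi hj.le hz hzi hb)
  obtain ⟨hb1, hb2⟩ := farmSouth_bounds hs hA.fit hi
  have hw1 : ridgesWest c n ≤ 1 := by rw [ridgesWest]; linarith
  have hbig : ∀ {x : ℝ}, 2 * ridgesWidth c n + ridgesWest c n + farmSide c m < x →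
      ¬ ENNReal.ofReal x ≤ T.geoDist z (P a) := fun {x} hx hle' => by
    have := hle'.trans hle
    rw [ENNReal.ofReal_le_ofReal_iff (by linarith)] at this
    linarith
  -- The two entries are the lower bounds for paths that reach height 0 and for paths that do not.
  refine hbig (x := min h (ridgesWest c n + 2 * farmSide c m - 3 * ε - ω))
    (lt_min (by linarith) (by linarith)) (le_iInf fun γ => ?_)
  by_cases h0 : ∃ t, T.height (γ t) = 0
  · obtain ⟨t, ht⟩ := h0
    exact (ENNReal.ofReal_le_ofReal (min_le_left _ _)).trans
      (hT.ofReal_le_pathLength hA.c_pos hA.one_le_n hj hz γ ht)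
  · push Not at h0
    rcases hP a with h1 | ⟨l, hl, hal⟩
    · exact absurd (by rw [γ.target]; exact h1) (h0 1)
    · refine (ENNReal.ofReal_le_ofReal (min_le_right _ _)).trans
        (hT.le_pathLength_of_mem_farm hA ?_ hz hzi hal γ h0)
      rintro rfl
      exact hcon hal

/-- The lines between the rectangles of the ridges belong to the skeleton. -/
theorem mem_skeleton_of_ridgeLine (hT : IsFarmingTerrain T c n m k ω ε h) (hc : 0 < c)
    (hn : 1 ≤ n) (hw : 0 ≤ ridgesWest c n) {j : ℕ} (hj : j + 1 < 2 * n) {z : unitSquare}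
    (hz : (z : Plane) 0 = ridgeLine c n (j + 1)) : z ∈ T.skeleton := by
  by_contra hcon
  obtain ⟨r, hr, A, hA⟩ := T.exists_affine_of_notMem_skeleton hcon (pt 1 0)
  set D := ridgesWidth c n / (2 * n) with hD
  have hDpos : 0 < D := by
    have := ridgesWidth_pos hc n
    have : (0 : ℝ) < n := by exact_mod_cast hn
    positivity
  have hs1 := ridgeLine_succ c n j
  have hs2 := ridgeLine_succ c n (j + 1)
  rw [← hD] at hs1 hs2
  have hl0 := (ridgeLine_mem_Icc hc hn hw (j := j) (by omega)).1
  have hl1 := (ridgeLine_mem_Icc hc hn hw (j := j + 1 + 1) (by omega)).2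
  obtain ⟨t, ht, htr, htD⟩ : ∃ t > 0, t ≤ r ∧ t ≤ D :=
    ⟨min r D, lt_min hr hDpos, min_le_left _ _, min_le_right _ _⟩
  have hx : ∀ u : ℝ, ((z : Plane) + u • pt 1 0) 0 = ridgeLine c n (j + 1) + u := fun u => by
    simp [hz]
  have hmem : ∀ u : ℝ, |u| ≤ t → (z : Plane) + u • pt 1 0 ∈ unitSquare := by
    intro u hu
    rw [abs_le] at hu
    rw [← pt_eta ((z : Plane) + u • pt 1 0), pt_mem_unitSquare, hx]
    refine ⟨⟨by linarith [hu.1], by linarith [hu.2]⟩, ?_⟩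
    simpa using z.2 1
  -- Affine functions satisfy the midpoint identity, whereas at a crest or valley both neighbours
  -- differ from the middle by `t` in the same direction.
  have hmid : A ((z : Plane) + t • pt 1 0) + A ((z : Plane) + (-t) • pt 1 0)
      = 2 * A ((z : Plane) + (0 : ℝ) • pt 1 0) := by
    have hlin : ∀ x, A x = A.linear x + A 0 := fun x => congrFun A.decomp x
    rw [hlin, hlin ((z : Plane) + (-t) • pt 1 0), hlin ((z : Plane) + (0 : ℝ) • pt 1 0)]
    simp only [map_add, map_smul, smul_eq_mul]
    ring
  have habs : |t| ≤ t := (abs_of_pos ht).le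
  have habs' : |-t| ≤ t := by rw [abs_neg]; exact habs
  have habs0 : |(0 : ℝ)| ≤ t := by rw [abs_zero]; exact ht.le
  rw [← hA t (habs.trans htr), ← hA (-t) (habs'.trans htr), ← hA 0 (habs0.trans htr)] at hmid
  rcases Nat.even_or_odd j with he | ho
  · have e1 := hT.height_ridge_down (j + 1) hj he.add_one _ (hmem t habs)
      (by rw [hx]; constructor <;> linarith)
    have e2 := hT.height_ridge_up j (by omega) he _ (hmem (-t) habs')
      (by rw [hx]; constructor <;> linarith)
    have e3 := hT.height_ridge_up j (by omega) he _ (hmem 0 habs0)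
      (by rw [hx]; constructor <;> linarith)
    rw [hx] at e1 e2 e3
    linarith
  · have e1 := hT.height_ridge_up (j + 1) hj ho.add_one _ (hmem t habs)
      (by rw [hx]; constructor <;> linarith)
    have e2 := hT.height_ridge_down j (by omega) ho _ (hmem (-t) habs')
      (by rw [hx]; constructor <;> linarith)
    have e3 := hT.height_ridge_down j (by omega) ho _ (hmem 0 habs0)
      (by rw [hx]; constructor <;> linarith)
    rw [hx] at e1 e2 e3
    linarith

end IsFarmingTerrain

/-! ### Counting points of two cells on the ridge lines. -/

theorem eq_of_mem_farm {c : ℝ} {m i l : ℕ} (hs : 0 < farmSide c m) {p : Plane}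
    (hi : p ∈ farm c m i) (hl : p ∈ farm c m l) : i = l := by
  have hd := farmSouth_sub_farmSouth c m i l
  have h1 := hi.2
  have h2 := hl.2
  have : ((l : ℤ) - i : ℤ) = 0 := by
    generalize ((l : ℤ) - i : ℤ) = x at hd
    by_contra hx
    rcases lt_or_gt_of_ne hx with hx | hx
    · have : (x : ℝ) ≤ -1 := by exact_mod_cast (show x ≤ -1 by omega)
      nlinarith [h1.2, h2.1]
    · have : (1 : ℝ) ≤ x := by exact_mod_cast hx
      nlinarith [h1.1, h2.2]
  omega

theorem Terrain.exists_mem_cell (T : Terrain) {M : ℕ} (P : Fin M → unitSquare) (a₀ : Fin M)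
    (z : unitSquare) : ∃ a, z ∈ T.cell P a := by
  obtain ⟨a, -, ha⟩ := Finset.exists_min_image Finset.univ (fun a => T.geoDist z (P a))
    ⟨a₀, Finset.mem_univ _⟩
  exact ⟨a, fun b => ha b (Finset.mem_univ b)⟩

/-- The farms that contain a site. -/
def occupied (c : ℝ) (m k : ℕ) {M : ℕ} (P : Fin M → unitSquare) : Finset ℕ :=
  open scoped Classical in (Finset.range k).filter fun i => ∃ a, (P a : Plane) ∈ farm c m i

theorem mem_occupied {c : ℝ} {m k : ℕ} {M : ℕ} {P : Fin M → unitSquare} {i : ℕ} :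
    i ∈ occupied c m k P ↔ i < k ∧ ∃ a, (P a : Plane) ∈ farm c m i := by
  simp [occupied]

theorem farmSouth_strictAnti {c : ℝ} {m : ℕ} (hs : 0 < farmSide c m) :
    StrictAnti (farmSouth c m) := by
  intro i l h
  have : (i : ℝ) < l := by exact_mod_cast h
  simp only [farmSouth]
  nlinarith

namespace IsFarmingTerrain

variable {T : Terrain} {c : ℝ} {n m k : ℕ} {ω ε h : ℝ} {M : ℕ} {P : Fin M → unitSquare}

/-- On every ridge line there is a point of at least two cells between two occupied farms. -/
theorem exists_two_le_incident (hT : IsFarmingTerrain T c n m k ω ε h)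
    (hA : Admissible c n m k ω ε h)
    (hP : ∀ a, T.height (P a) = 0 ∨ ∃ l < k, (P a : Plane) ∈ farm c m l) {i l : ℕ} (hil : i < l)
    (hi : i ∈ occupied c m k P) (hl : l ∈ occupied c m k P) {j : ℕ} (hj : j < 2 * n) :
    ∃ z : unitSquare, (z : Plane) 0 = ridgeLine c n j ∧ farmSouth c m l < (z : Plane) 1 ∧
      (z : Plane) 1 < farmSouth c m i ∧ 2 ≤ (T.incident P z).encard := by
  rw [mem_occupied] at hi hl
  have hs := hA.side_pos
  have hw : 0 ≤ ridgesWest c n := by linarith [hA.gap, hA.ε_pos]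
  have hx := ridgeLine_mem_Icc hA.c_pos hA.one_le_n hw hj.le
  let f : unitInterval → unitSquare := fun y => ⟨pt (ridgeLine c n j) y,
    pt_mem_unitSquare.2 ⟨hx, y.2⟩⟩
  have hf : ∀ q, Continuous fun y => T.geoDist (f y) q := by
    intro q
    refine continuous_of_le_add_edist 1 (by simp) fun y y' => ?_
    rw [one_mul, add_comm]
    refine (T.geoDist_triangle (f y) (f y') q).trans (add_le_add ?_ le_rfl)
    refine (hT.geoDist_same_ridgeLine hA.c_pos hA.one_le_n hj (z := f y) (z' := f y')
      rfl rfl).trans ?_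
    rw [Subtype.edist_eq, edist_dist, Real.dist_eq]
    rfl
  have hclosed : ∀ a, IsClosed {y | f y ∈ T.cell P a} := by
    intro a
    have : {y | f y ∈ T.cell P a} = ⋂ b, {y | T.geoDist (f y) (P a) ≤ T.geoDist (f y) (P b)} := by
      ext y; simp [Terrain.cell]
    rw [this]
    exact isClosed_iInter fun b => isClosed_le (hf _) (hf _)
  -- The sites are split into those on farms up to number `i` and all others. At the latitude of
  -- farm `i` only the first group is nearest, at that of farm `l` only the second; connectedness of
  -- the segment gives a point that belongs to both.
  let I : Set (Fin M) := {a | ∃ b ≤ i, (P a : Plane) ∈ farm c m b}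
  let U : Set unitInterval := ⋃ a ∈ I, {y | f y ∈ T.cell P a}
  let V : Set unitInterval := ⋃ a ∈ Iᶜ, {y | f y ∈ T.cell P a}
  have hU : IsClosed U := (Set.toFinite I).isClosed_biUnion fun a _ => hclosed a
  have hV : IsClosed V := (Set.toFinite Iᶜ).isClosed_biUnion fun a _ => hclosed a
  have hbound : ∀ b < k, farmSouth c m b ∈ Set.Icc (0 : ℝ) 1 := fun b hb => by
    obtain ⟨h1, h2⟩ := farmSouth_bounds hs hA.fit hb
    exact ⟨by linarith, by linarith⟩
  let yi : unitInterval := ⟨farmSouth c m i, hbound i hi.1⟩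
  let yl : unitInterval := ⟨farmSouth c m l, hbound l hl.1⟩
  have hlt : farmSouth c m l < farmSouth c m i := farmSouth_strictAnti hs hil
  have hyle : yl ≤ yi := hlt.le
  obtain ⟨a₀, ha₀⟩ := hi.2
  have hcells : ∀ y, ∃ a, f y ∈ T.cell P a := fun y => T.exists_mem_cell P a₀ (f y)
  have hcelli : ∀ a, f yi ∈ T.cell P a → a ∈ I := fun a ha =>
    ⟨i, le_rfl, hT.mem_farm_of_mem_cell hA hP hi.1 hi.2 hj rfl rfl ha⟩
  have hcelll : ∀ a, f yl ∈ T.cell P a → a ∉ I := by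
    rintro a ha ⟨b, hb, hab⟩
    have := hT.mem_farm_of_mem_cell hA hP hl.1 hl.2 hj rfl rfl ha
    have := eq_of_mem_farm hs hab this
    omega
  obtain ⟨y, ⟨hy1, hy2⟩, hyU, hyV⟩ := isPreconnected_closed_iff.1 (isPreconnected_Icc (a := yl)
    (b := yi)) U V hU hV
    (fun y _ => by
      obtain ⟨a, ha⟩ := hcells y
      by_cases hI : a ∈ I
      · exact .inl (Set.mem_iUnion₂.2 ⟨a, hI, ha⟩)
      · exact .inr (Set.mem_iUnion₂.2 ⟨a, hI, ha⟩))
    (by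
      obtain ⟨a, ha⟩ := hcells yi
      exact ⟨yi, ⟨hyle, le_rfl⟩, Set.mem_iUnion₂.2 ⟨a, hcelli a ha, ha⟩⟩)
    (by
      obtain ⟨a, ha⟩ := hcells yl
      exact ⟨yl, ⟨le_rfl, hyle⟩, Set.mem_iUnion₂.2 ⟨a, hcelll a ha, ha⟩⟩)
  obtain ⟨a, haI, ha⟩ := Set.mem_iUnion₂.1 hyU
  obtain ⟨b, hbI, hb⟩ := Set.mem_iUnion₂.1 hyV
  have hne1 : yl ≠ y := by
    rintro rfl
    exact hcelll a ha haI
  have hne2 : y ≠ yi := by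
    rintro rfl
    exact hbI (hcelli b hb)
  have hlt1 : yl < y := lt_of_le_of_ne hy1 hne1
  have hlt2 : y < yi := lt_of_le_of_ne hy2 hne2
  refine ⟨f y, rfl, hlt1, hlt2, ?_⟩
  refine Order.add_one_le_of_lt (Set.one_lt_encard_iff.2 ⟨a, b, ha, hb, ?_⟩)
  rintro rfl
  exact hbI haI

/-- The complexity grows with the number of ridges and the number of occupied farms. -/
theorem mul_card_occupied_le (hT : IsFarmingTerrain T c n m k ω ε h)
    (hA : Admissible c n m k ω ε h)
    (hP : ∀ a, T.height (P a) = 0 ∨ ∃ l < k, (P a : Plane) ∈ farm c m l) :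
    (((2 * n - 1) * ((occupied c m k P).card - 1) : ℕ) : ℕ∞) ≤ T.voronoiComplexity P := by
  refine le_trans ?_ (T.encard_le_voronoiComplexity P)
  set N := (occupied c m k P).card with hN
  have hs := hA.side_pos
  have hw : 0 ≤ ridgesWest c n := by linarith [hA.gap, hA.ε_pos]
  let σ := (occupied c m k P).orderEmbOfFin hN.symm
  have hσ : ∀ r, σ r ∈ occupied c m k P := fun r => Finset.orderEmbOfFin_mem _ _ r
  have hex : ∀ x : Fin (2 * n - 1) × Fin (N - 1), ∃ z : unitSquare,
      (z : Plane) 0 = ridgeLine c n (x.1 + 1) ∧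
      farmSouth c m (σ ⟨x.2 + 1, by omega⟩) < (z : Plane) 1 ∧
      (z : Plane) 1 < farmSouth c m (σ ⟨x.2, by omega⟩) ∧ 2 ≤ (T.incident P z).encard := by
    intro x
    refine hT.exists_two_le_incident hA hP (σ.strictMono ?_) (hσ _) (hσ _) (by omega)
    exact Nat.lt_succ_self _
  choose F hF0 hF1 hF2 hF3 using hex
  have hanti := (farmSouth_strictAnti (c := c) (m := m) hs).antitone
  have hsep : ∀ x x' : Fin (2 * n - 1) × Fin (N - 1), x.2 < x'.2 →
      (F x' : Plane) 1 < (F x : Plane) 1 := by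
    intro x x' hlt
    refine ((hF2 x').trans_le (hanti ?_)).trans (hF1 x)
    exact σ.monotone (Nat.succ_le_of_lt hlt)
  have hinj : Function.Injective F := by
    intro x x' hxx
    have h1 : x.1 = x'.1 := by
      have := hF0 x
      rw [hxx, hF0 x'] at this
      have := (ridgeLine_strictMono hA.c_pos hA.one_le_n).injective this
      exact Fin.ext (by omega)
    have h2 : x.2 = x'.2 := by
      rcases lt_trichotomy x.2 x'.2 with hlt | he | hlt
      · have := hsep x x' hlt
        rw [hxx] at this
        exact absurd this (lt_irrefl _)
      · exact he
      · have := hsep x' x hlt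
        rw [hxx] at this
        exact absurd this (lt_irrefl _)
    exact Prod.ext h1 h2
  have hrange : Set.range F ⊆ {z | z ∈ T.skeleton ∧ 2 ≤ (T.incident P z).encard} := by
    rintro _ ⟨x, rfl⟩
    exact ⟨hT.mem_skeleton_of_ridgeLine hA.c_pos hA.one_le_n hw (by omega) (hF0 x), hF3 x⟩
  refine le_trans (le_of_eq ?_) (Set.encard_le_encard hrange)
  rw [← Set.image_univ, hinj.encard_image, Set.encard_univ, ENat.card_eq_coe_fintype_card]
  simp

end IsFarmingTerrain

/-! ### Random sites: occupied farms and bad strips. -/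

open MeasureTheory

/-- A product set, as a set of points of the unit square. -/
def box (A B : Set ℝ) : Set unitSquare := {p | (p : Plane) 0 ∈ A ∧ (p : Plane) 1 ∈ B}

theorem measurable_coord (i : Fin 2) : Measurable fun p : unitSquare => (p : Plane) i := by
  have : Measurable fun p : Plane => p i := by fun_prop
  exact this.comp measurable_subtype_coe

theorem measurableSet_box {A B : Set ℝ} (hA : MeasurableSet A) (hB : MeasurableSet B) :
    MeasurableSet (box A B) :=
  (measurable_coord 0 hA).inter (measurable_coord 1 hB)

theorem measurableSet_unitSquare : MeasurableSet unitSquare := by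
  have : unitSquare = ⋂ i, (fun p : Plane => p i) ⁻¹' Set.Icc 0 1 := by
    ext p; simp [unitSquare]
  rw [this]
  exact MeasurableSet.iInter fun i =>
    (show Measurable fun p : Plane => p i by fun_prop) measurableSet_Icc

theorem uniformSquare_box (A B : Set ℝ) :
    uniformSquare (box A B) = volume (A ∩ Set.Icc 0 1) * volume (B ∩ Set.Icc 0 1) := by
  rw [uniformSquare, (MeasurableEmbedding.subtype_coe measurableSet_unitSquare).comap_apply]
  have himage : ((↑) : unitSquare → Plane) '' box A B
      = (MeasurableEquiv.toLp 2 (Fin 2 → ℝ)).symm ⁻¹'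
        (Set.univ.pi ![A ∩ Set.Icc 0 1, B ∩ Set.Icc 0 1]) := by
    ext p
    simp only [box, unitSquare, Set.mem_image, Set.mem_ofPred_eq, Subtype.exists,
      Fin.forall_fin_two,
      Set.mem_preimage, Set.mem_univ_pi, Matrix.cons_val_zero, Matrix.cons_val_one,
      Set.mem_inter_iff, Set.mem_Icc]
    constructor
    · rintro ⟨q, ⟨h3, h4⟩, ⟨h1, h2⟩, rfl⟩
      exact ⟨⟨h1, h3⟩, h2, h4⟩
    · rintro ⟨⟨h1, h3⟩, h2, h4⟩
      exact ⟨p, ⟨h3, h4⟩, ⟨h1, h2⟩, rfl⟩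
  rw [himage, (EuclideanSpace.volume_preserving_symm_measurableEquiv_toLp
    (Fin 2)).measure_preimage_equiv, volume_pi_pi, Fin.prod_univ_two]
  rfl

instance : IsProbabilityMeasure uniformSquare := ⟨by
  have : (Set.univ : Set unitSquare) = box Set.univ Set.univ := by ext; simp [box]
  rw [this, uniformSquare_box]
  simp⟩

instance (m : ℕ) : IsProbabilityMeasure (siteLaw m) := by
  unfold siteLaw; infer_instance

theorem uniformSquare_box_univ_right_le (a b : ℝ) :
    uniformSquare (box (Set.Icc a b) Set.univ) ≤ ENNReal.ofReal (b - a) := by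
  rw [uniformSquare_box, ← Real.volume_Icc]
  calc volume (Set.Icc a b ∩ Set.Icc 0 1) * volume (Set.univ ∩ Set.Icc (0 : ℝ) 1)
      ≤ volume (Set.Icc a b) * 1 := by
        gcongr
        · exact Set.inter_subset_left
        · simp
    _ = _ := mul_one _

theorem uniformSquare_box_univ_left_le (a b : ℝ) :
    uniformSquare (box Set.univ (Set.Icc a b)) ≤ ENNReal.ofReal (b - a) := by
  rw [uniformSquare_box, ← Real.volume_Icc]
  calc volume (Set.univ ∩ Set.Icc (0 : ℝ) 1) * volume (Set.Icc a b ∩ Set.Icc 0 1)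
      ≤ 1 * volume (Set.Icc a b) := by
        gcongr
        · simp
        · exact Set.inter_subset_left
    _ = _ := one_mul _

/-- The positions of sites which are neither on a farm nor deep in the forbidden area are in
this union of thin strips. -/
def badStrips (c : ℝ) (n m k : ℕ) (ω ε : ℝ) : Set unitSquare :=
  box (Set.Icc (ridgesWest c n - ε) 1) Set.univ ∪
    box (Set.Icc (farmSide c m) (farmSide c m + ε)) Set.univ ∪
    ⋃ i ∈ Finset.range k,
      (box Set.univ (Set.Icc (farmSouth c m i - ε) (farmSouth c m i + ω + ε)) ∪
        box Set.univ (Set.Icc (farmSouth c m i + farmSide c m)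
          (farmSouth c m i + farmSide c m + ε)))

theorem measurableSet_badStrips (c : ℝ) (n m k : ℕ) (ω ε : ℝ) :
    MeasurableSet (badStrips c n m k ω ε) := by
  refine .union (.union ?_ ?_) (Finset.measurableSet_biUnion _ fun i _ => .union ?_ ?_) <;>
  exact measurableSet_box (by measurability) (by measurability)

theorem uniformSquare_badStrips_le (c : ℝ) (n m k : ℕ) {ω ε : ℝ} (hω : 0 ≤ ω) (hε : 0 ≤ ε)
    (hW : 0 ≤ ridgesWidth c n) : uniformSquare (badStrips c n m k ω ε) ≤
      ENNReal.ofReal (ridgesWidth c n + 2 * ε + k * (ω + 3 * ε)) := by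
  have h1 : uniformSquare (box (Set.Icc (ridgesWest c n - ε) 1) Set.univ)
      ≤ ENNReal.ofReal (ridgesWidth c n + ε) :=
    (uniformSquare_box_univ_right_le _ _).trans_eq (by rw [ridgesWest]; congr 1; ring)
  have h2 : uniformSquare (box (Set.Icc (farmSide c m) (farmSide c m + ε)) Set.univ)
      ≤ ENNReal.ofReal ε :=
    (uniformSquare_box_univ_right_le _ _).trans_eq (by congr 1; ring)
  have h3 : ∀ i, uniformSquare
      (box Set.univ (Set.Icc (farmSouth c m i - ε) (farmSouth c m i + ω + ε)) ∪
        box Set.univ (Set.Icc (farmSouth c m i + farmSide c m)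
          (farmSouth c m i + farmSide c m + ε))) ≤ ENNReal.ofReal (ω + 3 * ε) := by
    intro i
    refine (measure_union_le _ _).trans ((add_le_add (uniformSquare_box_univ_left_le _ _)
      (uniformSquare_box_univ_left_le _ _)).trans_eq ?_)
    rw [← ENNReal.ofReal_add (by linarith) (by linarith)]
    congr 1; ring
  have h4 := (measure_biUnion_finset_le (μ := uniformSquare) (Finset.range k) fun i =>
      (box Set.univ (Set.Icc (farmSouth c m i - ε) (farmSouth c m i + ω + ε)) ∪
        box Set.univ (Set.Icc (farmSouth c m i + farmSide c m)
          (farmSouth c m i + farmSide c m + ε)))).trans (Finset.sum_le_sum fun i _ => h3 i)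
  rw [Finset.sum_const, Finset.card_range, nsmul_eq_mul, ← ENNReal.ofReal_natCast,
    ← ENNReal.ofReal_mul (Nat.cast_nonneg k)] at h4
  refine (measure_union_le _ _).trans ((add_le_add ((measure_union_le _ _).trans
    (add_le_add h1 h2)) h4).trans_eq ?_)
  rw [← ENNReal.ofReal_add (by linarith) hε, ← ENNReal.ofReal_add (by linarith) (by positivity)]
  congr 1; ring

/-- The strips contain the ridges, the roads and the parts of all `ε`-neighbourhoods outside the
farms. They also cut into the farms, which costs only a little probability. -/
theorem IsFarmingTerrain.of_notMem_badStrips {T : Terrain} {c : ℝ} {n m k : ℕ} {ω ε h : ℝ}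
    (hT : IsFarmingTerrain T c n m k ω ε h) (hω : 0 ≤ ω) {p : unitSquare} (hε : 0 < ε)
    (hp : p ∉ badStrips c n m k ω ε) :
    T.height p = 0 ∨ ∃ l < k, (p : Plane) ∈ farm c m l := by
  by_contra! hcon
  obtain ⟨hne, hfarm⟩ := hcon
  obtain ⟨q, hq, h0, h1⟩ := hT.exists_near_of_height_ne_zero p.2 hne
  rw [abs_lt] at h0 h1
  simp only [badStrips, box, Set.mem_union, Set.mem_iUnion, Set.mem_ofPred_eq, Set.mem_univ,
    and_true, true_and, Finset.mem_range, not_or, not_exists, Set.mem_Icc, not_and] at hp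
  obtain ⟨⟨hp1, hp2⟩, hp3⟩ := hp
  rcases hq with hq | hq
  · obtain ⟨i, hi, hq | hq⟩ := Set.mem_iUnion₂.1 hq
    · obtain ⟨h5, h6⟩ := hp3 i hi
      refine hfarm i hi ⟨⟨(p.2 0).1, ?_⟩, ?_, ?_⟩
      · by_contra! h
        exact hp2 h.le (by linarith [hq.1.2])
      · by_contra! h
        exact h5 (by linarith [hq.2.1]) (by linarith)
      · by_contra! h
        exact h6 h.le (by linarith [hq.2.2])
    · exact (hp3 i hi).1 (by linarith [hq.2.1]) (by linarith [hq.2.2])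
  · exact hp1 (by linarith [hq.2]) (p.2 0).2

/-- The event that the `i`-th farm contains a site. -/
def occupiedEvent (c : ℝ) (m i : ℕ) : Set (Fin m → unitSquare) :=
  {P | ∃ a, (P a : Plane) ∈ farm c m i}

/-- The event that no site is in a bad strip. -/
def goodEvent (c : ℝ) (n m k : ℕ) (ω ε : ℝ) : Set (Fin m → unitSquare) :=
  {P | ∀ a, P a ∉ badStrips c n m k ω ε}

theorem farm_preimage (c : ℝ) (m i : ℕ) : {p : unitSquare | (p : Plane) ∈ farm c m i} =
    box (Set.Icc 0 (farmSide c m)) (Set.Icc (farmSouth c m i) (farmSouth c m i + farmSide c m)) :=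
  rfl

theorem measurableSet_occupiedEvent (c : ℝ) (m i : ℕ) : MeasurableSet (occupiedEvent c m i) := by
  have : occupiedEvent c m i
      = ⋃ a, Function.eval a ⁻¹' {p : unitSquare | (p : Plane) ∈ farm c m i} := by
    ext P; simp [occupiedEvent]
  rw [this]
  refine MeasurableSet.iUnion fun a => measurable_pi_apply a ?_
  rw [farm_preimage]
  exact measurableSet_box measurableSet_Icc measurableSet_Icc

theorem measurableSet_goodEvent (c : ℝ) (n m k : ℕ) (ω ε : ℝ) :
    MeasurableSet (goodEvent c n m k ω ε) := by
  have : goodEvent c n m k ω ε = ⋂ a, Function.eval a ⁻¹' (badStrips c n m k ω ε)ᶜ := by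
    ext P; simp [goodEvent]
  rw [this]
  exact MeasurableSet.iInter fun a =>
    measurable_pi_apply a (measurableSet_badStrips c n m k ω ε).compl

theorem siteLaw_compl_goodEvent_le (c : ℝ) (n m k : ℕ) {ω ε : ℝ} (hω : 0 ≤ ω) (hε : 0 ≤ ε)
    (hW : 0 ≤ ridgesWidth c n) : siteLaw m (goodEvent c n m k ω ε)ᶜ ≤
      ENNReal.ofReal (m * (ridgesWidth c n + 2 * ε + k * (ω + 3 * ε))) := by
  have : (goodEvent c n m k ω ε)ᶜ = ⋃ a, Function.eval a ⁻¹' (badStrips c n m k ω ε) := by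
    ext P; simp [goodEvent]
  rw [this]
  refine (measure_iUnion_le _).trans ?_
  have h : ∀ a, siteLaw m (Function.eval a ⁻¹' (badStrips c n m k ω ε))
      = uniformSquare (badStrips c n m k ω ε) := fun a =>
    (measurePreserving_eval (fun _ : Fin m => uniformSquare) a).measure_preimage
      (measurableSet_badStrips c n m k ω ε).nullMeasurableSet
  simp_rw [h]
  rw [tsum_fintype, Finset.sum_const, Finset.card_univ, Fintype.card_fin, nsmul_eq_mul,
    ENNReal.ofReal_mul (Nat.cast_nonneg m), ENNReal.ofReal_natCast]
  gcongr
  exact uniformSquare_badStrips_le c n m k hω hε hW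

/-- By independence the probability is `(1 - s²)^m ≤ exp(-m s²)`, and `m s² = 1/c²`: the side of the
farms is scaled to make this independent of `m`. -/
theorem siteLaw_compl_occupiedEvent_le {c : ℝ} (hc : 0 < c) {m k : ℕ} (hm : 1 ≤ m)
    (hk : 3 * k * farmSide c m ≤ 1) {i : ℕ} (hi : i < k) :
    siteLaw m (occupiedEvent c m i)ᶜ ≤ ENNReal.ofReal (Real.exp (-(1 / c ^ 2))) := by
  have hm0 : (0 : ℝ) < m := by exact_mod_cast hm
  have hs : 0 < farmSide c m := by unfold farmSide; positivity
  obtain ⟨h1, h2⟩ := farmSouth_bounds hs hk hi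
  have hcompl : (occupiedEvent c m i)ᶜ
      = Set.univ.pi fun _ : Fin m => {p : unitSquare | (p : Plane) ∈ farm c m i}ᶜ := by
    ext P; simp [occupiedEvent]
  have hfarm : uniformSquare {p : unitSquare | (p : Plane) ∈ farm c m i}
      = ENNReal.ofReal (farmSide c m ^ 2) := by
    rw [farm_preimage, uniformSquare_box, Set.inter_eq_left.2 (Set.Icc_subset_Icc le_rfl
      (by linarith)), Set.inter_eq_left.2 (Set.Icc_subset_Icc (by linarith) (by linarith)),
      Real.volume_Icc, Real.volume_Icc, ← ENNReal.ofReal_mul (by linarith)]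
    congr 1; ring
  have hmeas : MeasurableSet {p : unitSquare | (p : Plane) ∈ farm c m i} := by
    rw [farm_preimage]; exact measurableSet_box measurableSet_Icc measurableSet_Icc
  have hs1 : farmSide c m ^ 2 ≤ 1 := by nlinarith
  rw [hcompl, siteLaw, Measure.pi_pi, Finset.prod_const, Finset.card_univ, Fintype.card_fin,
    prob_compl_eq_one_sub hmeas, hfarm, ← ENNReal.ofReal_one, ← ENNReal.ofReal_sub _ (by positivity),
    ← ENNReal.ofReal_pow (by linarith)]
  refine ENNReal.ofReal_le_ofReal ?_
  have hms : (m : ℝ) * farmSide c m ^ 2 = 1 / c ^ 2 := by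
    rw [farmSide, div_pow, mul_pow, Real.sq_sqrt hm0.le]
    field_simp
  calc (1 - farmSide c m ^ 2) ^ m ≤ Real.exp (-(farmSide c m ^ 2)) ^ m :=
        pow_le_pow_left₀ (by linarith) (Real.one_sub_le_exp_neg _) m
    _ = Real.exp (-(1 / c ^ 2)) := by
        rw [← Real.exp_nat_mul, ← hms]; congr 1; ring

/-- Union bound: with `p = 1 - exp(-1/c²)`, the farm is occupied with probability at least `p`, and
the bad strips cost at most `p / 2`. -/
theorem le_siteLaw_inter {c : ℝ} (hc : 0 < c) {n m k : ℕ} (hm : 1 ≤ m)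
    (hk : 3 * k * farmSide c m ≤ 1) {ω ε : ℝ} (hω : 0 ≤ ω) (hε : 0 ≤ ε)
    (hbad : m * (ridgesWidth c n + 2 * ε + k * (ω + 3 * ε))
      ≤ (1 - Real.exp (-(1 / c ^ 2))) / 2) {i : ℕ} (hi : i < k) :
    ENNReal.ofReal ((1 - Real.exp (-(1 / c ^ 2))) / 2)
      ≤ siteLaw m (occupiedEvent c m i ∩ goodEvent c n m k ω ε) := by
  have h1 := siteLaw_compl_occupiedEvent_le hc hm hk hi
  have h2 := (siteLaw_compl_goodEvent_le c n m k hω hε (ridgesWidth_pos hc n).le).trans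
    (ENNReal.ofReal_le_ofReal hbad)
  have hun : (Set.univ : Set (Fin m → unitSquare)) ⊆
      (occupiedEvent c m i ∩ goodEvent c n m k ω ε) ∪
        ((occupiedEvent c m i)ᶜ ∪ (goodEvent c n m k ω ε)ᶜ) := by
    intro P _
    by_cases ha : P ∈ occupiedEvent c m i <;> by_cases hb : P ∈ goodEvent c n m k ω ε <;>
      simp [ha, hb]
  have h3 := (measure_mono (μ := siteLaw m) hun).trans ((measure_union_le _ _).trans
    (add_le_add le_rfl ((measure_union_le _ _).trans (add_le_add h1 h2))))
  have hexp : Real.exp (-(1 / c ^ 2)) ≤ 1 := Real.exp_le_one_iff.2 (by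
    have : 0 ≤ 1 / c ^ 2 := by positivity
    linarith)
  rw [measure_univ, ← ENNReal.ofReal_add (Real.exp_pos _).le (by linarith)] at h3
  have h4 := tsub_le_iff_right.2 h3
  rw [← ENNReal.ofReal_one, ← ENNReal.ofReal_sub _ (by linarith [Real.exp_pos (-(1 / c ^ 2))])] at h4
  refine le_trans (le_of_eq ?_) h4
  congr 1; ring

/-- The pointwise bound on the good event is integrated. The indicators on the smaller side are
measurable, and monotonicity needs no measurability of the complexity. Keeping `n` on the right
avoids a subtraction. -/
theorem IsFarmingTerrain.sum_le_expectedComplexity {T : Terrain} {c : ℝ} {n m k : ℕ} {ω ε h : ℝ}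
    (hT : IsFarmingTerrain T c n m k ω ε h) (hA : Admissible c n m k ω ε h) :
    n * ∑ i ∈ Finset.range k, siteLaw m (occupiedEvent c m i ∩ goodEvent c n m k ω ε)
      ≤ expectedComplexity T m + n := by
  have hmeas : ∀ i, MeasurableSet (occupiedEvent c m i ∩ goodEvent c n m k ω ε) := fun i =>
    (measurableSet_occupiedEvent c m i).inter (measurableSet_goodEvent c n m k ω ε)
  have hpt : ∀ P : Fin m → unitSquare,
      (n : ℝ≥0∞) * ∑ i ∈ Finset.range k,
        (occupiedEvent c m i ∩ goodEvent c n m k ω ε).indicator (1 : (Fin m → unitSquare) → ℝ≥0∞) P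
      ≤ (T.voronoiComplexity P : ℝ≥0∞) + n := by
    classical
    intro P
    by_cases hP : P ∈ goodEvent c n m k ω ε
    · have hcard : ∑ i ∈ Finset.range k,
          (occupiedEvent c m i ∩ goodEvent c n m k ω ε).indicator (1 : (Fin m → unitSquare) → ℝ≥0∞) P
          = ((occupied c m k P).card : ℝ≥0∞) := by
        rw [occupied, Finset.card_filter, Nat.cast_sum]
        refine Finset.sum_congr rfl fun i _ => ?_
        simp [Set.indicator_apply, hP, occupiedEvent]
      have hle := hT.mul_card_occupied_le hA (P := P) fun a =>
        hT.of_notMem_badStrips hA.ω_nonneg hA.ε_pos (hP a)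
      have hle' : (((2 * n - 1) * ((occupied c m k P).card - 1) : ℕ) : ℝ≥0∞)
          ≤ (T.voronoiComplexity P : ℝ≥0∞) := by
        have := ENat.toENNReal_le.2 hle
        simpa using this
      rw [hcard]
      refine le_trans ?_ (add_le_add hle' le_rfl)
      -- Since `n ≤ 2 n - 1`, the count `(2 n - 1)(N - 1) + n` dominates `n N`; the added `n` also
      -- covers `N = 0`, where subtraction truncates.
      have hn := hA.one_le_n
      have hnat : n * (occupied c m k P).card
          ≤ (2 * n - 1) * ((occupied c m k P).card - 1) + n := by
        rcases Nat.eq_zero_or_pos (occupied c m k P).card with h0 | h0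
        · simp [h0]
        · obtain ⟨r, hr⟩ : ∃ r, (occupied c m k P).card = r + 1 :=
            ⟨_, (Nat.succ_pred_eq_of_pos h0).symm⟩
          rw [hr, Nat.add_sub_cancel, mul_add, mul_one]
          gcongr
          omega
      exact_mod_cast hnat
    · simp [hP]
  calc n * ∑ i ∈ Finset.range k, siteLaw m (occupiedEvent c m i ∩ goodEvent c n m k ω ε)
      = ∫⁻ P, n * ∑ i ∈ Finset.range k,
          (occupiedEvent c m i ∩ goodEvent c n m k ω ε).indicator (1 : (Fin m → unitSquare) → ℝ≥0∞) P
          ∂(siteLaw m) := by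
        rw [lintegral_const_mul _ (Finset.measurable_sum _ fun i _ =>
            measurable_one.indicator (hmeas i)),
          lintegral_finsetSum _ fun i _ => measurable_one.indicator (hmeas i)]
        congr 1
        exact Finset.sum_congr rfl fun i _ => (lintegral_indicator_one (hmeas i)).symm
    _ ≤ ∫⁻ P, ((T.voronoiComplexity P : ℝ≥0∞) + n) ∂(siteLaw m) := lintegral_mono hpt
    _ = expectedComplexity T m + n := by
        rw [lintegral_add_right _ measurable_const, lintegral_const, measure_univ, mul_one]
        rfl

end Farming

end

/-! ### Choice of the constants. -/

theorem mainTheorem3 (c κ : ℝ) (hc : 0 < c) (hκ : 0 < κ) :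
    ∃ (A K : ℝ) (m₀ : ℕ), 0 < K ∧ ∀ C : ℝ, ∃ n₀ : ℕ, ∀ n m : ℕ,
      n₀ ≤ n → m₀ ≤ m → (m : ℝ) ≤ C * n →
      ∃ η h₀ : ℝ, 0 < η ∧ ∀ (k : ℕ) (ω ε h : ℝ),
        κ * √(m : ℝ) ≤ k → 3 * (k : ℝ) ≤ c * √(m : ℝ) →
        0 ≤ ω → ω < η → 0 < ε → ε < η → h₀ ≤ h →
        (∃ T : Farming.Terrain, Farming.IsFarmingTerrain T c n m k ω ε h ∧
          (T.triangulation.vertices.ncard : ℝ) ≤ A * n) ∧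
        ∀ T : Farming.Terrain, Farming.IsFarmingTerrain T c n m k ω ε h →
          ENNReal.ofReal (K * (n * √(m : ℝ))) ≤ Farming.expectedComplexity T m := by
  open Farming in
  set p : ℝ := 1 - Real.exp (-(1 / c ^ 2)) with hp
  have hp0 : 0 < p := by
    have : Real.exp (-(1 / c ^ 2)) < 1 := Real.exp_lt_one_iff.2 (by
      have : 0 < 1 / c ^ 2 := by positivity
      linarith)
    linarith
  -- `44 = 30 + 10 + 4` bounds `5 (6 k + 2) + 4 n` for `1 ≤ k ≤ n`. The expected count is about `n
  -- (κ p √m / 2 - 1)`, and `m₀` makes the 1 at most half of the main term.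
  refine ⟨44, κ * p / 4, ⌈(4 / (κ * p)) ^ 2⌉₊ + 1, by positivity, fun C => ?_⟩
  -- The summands give, in turn, `n² ≤ 2^n`, `√m ≤ n`, `c √m ≤ n` and `4 m ≤ c p 2^n`; the last one
  -- makes the ridges negligible for the probability estimate.
  refine ⟨4 + ⌈C⌉₊ + ⌈c ^ 2 * C⌉₊ + ⌈4 * C / (c * p)⌉₊, fun n m hn hm hmC => ?_⟩
  have hn4 : 4 ≤ n := by omega
  have hnR : (4 : ℝ) ≤ n := by exact_mod_cast hn4
  have hnC : C ≤ n := (Nat.le_ceil C).trans (by exact_mod_cast (show ⌈C⌉₊ ≤ n by omega))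
  have hncC : c ^ 2 * C ≤ n :=
    (Nat.le_ceil _).trans (by exact_mod_cast (show ⌈c ^ 2 * C⌉₊ ≤ n by omega))
  have hnD : 4 * C / (c * p) ≤ n :=
    (Nat.le_ceil _).trans (by exact_mod_cast (show ⌈4 * C / (c * p)⌉₊ ≤ n by omega))
  have hm1 : 1 ≤ m := by omega
  have hmR : (1 : ℝ) ≤ m := by exact_mod_cast hm1
  have hsq : √(m : ℝ) ^ 2 = m := Real.sq_sqrt (by linarith)
  have hsqpos : 0 < √(m : ℝ) := Real.sqrt_pos.2 (by linarith)
  have hpow : (n : ℝ) ^ 2 ≤ 2 ^ n := by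
    have : n ^ 2 ≤ 2 ^ n := by
      clear * - hn4
      induction n, hn4 using Nat.le_induction with
      | base => norm_num
      | succ j hj ih => rw [pow_succ 2 j]; nlinarith
    exact_mod_cast this
  have hsn : √(m : ℝ) ≤ n := Real.sqrt_le_iff.2 ⟨by linarith, by nlinarith⟩
  have hcsn : c * √(m : ℝ) ≤ n := by
    refine abs_le_of_sq_le_sq' ?_ (by linarith) |>.2
    rw [mul_pow, hsq]
    nlinarith [mul_le_mul_of_nonneg_left hmC (sq_nonneg c)]
  have hs : 0 < farmSide c m := by unfold farmSide; positivity
  have hW := ridgesWidth_pos hc n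
  have hWle : ridgesWidth c n ≤ 1 / (c * 2 ^ n) := by
    unfold ridgesWidth
    refine one_div_le_one_div_of_le (by positivity) ?_
    have : 1 ≤ √(2 : ℝ) := Real.one_le_sqrt.2 (by norm_num)
    have : 0 < c * 2 ^ n := by positivity
    nlinarith
  have hWs : ridgesWidth c n ≤ farmSide c m / 4 := by
    refine hWle.trans ?_
    rw [farmSide, div_div]
    refine one_div_le_one_div_of_le (by positivity) ?_
    have : 4 * √(m : ℝ) ≤ 2 ^ n := by nlinarith
    nlinarith
  have hWm : m * ridgesWidth c n ≤ p / 4 := by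
    have h1 : 4 * (m : ℝ) ≤ c * p * 2 ^ n := by
      rw [div_le_iff₀ (by positivity)] at hnD
      have : 0 < c * p := by positivity
      nlinarith
    calc m * ridgesWidth c n ≤ m * (1 / (c * 2 ^ n)) := by gcongr
      _ ≤ p / 4 := by
        rw [mul_one_div, div_le_div_iff₀ (by positivity) (by norm_num)]
        linarith
  -- Chosen so that for `ω, ε < q` and `k ≤ c √m` the strips other than the ridges contribute at
  -- most `p / 4` to the bad probability; the ridges contribute another `p / 4`.
  set q : ℝ := p / (4 * m * (2 + 4 * (c * √(m : ℝ)))) with hq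
  have hq0 : 0 < q := by positivity
  -- With `W ≤ s/4`, the bound `s/8` on `ω` and `ε` gives `2W + 3ε + ω < s`, as `Admissible`
  -- requires.
  refine ⟨min (farmSide c m / 8) q, 4, lt_min (by positivity) hq0, ?_⟩
  intro k ω ε h hκk hkc hω hωη hε hεη hh
  have hω1 := hωη.trans_le (min_le_left _ _)
  have hω2 := hωη.trans_le (min_le_right _ _)
  have hε1 := hεη.trans_le (min_le_left _ _)
  have hε2 := hεη.trans_le (min_le_right _ _)
  have hk0 : 0 < k := by
    have : (0 : ℝ) < k := lt_of_lt_of_le (by positivity) hκk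
    exact_mod_cast this
  have hk1 : (1 : ℝ) ≤ k := by exact_mod_cast hk0
  have hfit : 3 * k * farmSide c m ≤ 1 := by
    rw [farmSide, mul_one_div, div_le_one (by positivity)]
    exact hkc
  have hs3 : farmSide c m ≤ 1 / 3 := by nlinarith
  have hgap : farmSide c m + 3 * ε < ridgesWest c n := by
    rw [ridgesWest]; linarith
  have hkn : (k : ℝ) ≤ n := by linarith
  refine ⟨?_, fun T hT => ?_⟩
  · obtain ⟨T, hT, hcard⟩ := exists_isFarmingTerrain hc (by omega : 1 ≤ n) hs hfit hω hε
      (h := h) (by linarith) (by linarith) (by linarith)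
    refine ⟨T, hT, ?_⟩
    have : (T.triangulation.vertices.ncard : ℝ) ≤ 5 * (6 * k + 2) + 4 * n := by
      exact_mod_cast hcard
    linarith
  · have hA : Admissible c n m k ω ε h :=
      ⟨hc, by omega, hs, hfit, hω, hε, by linarith, hgap, hh⟩
    have hbad : m * (ridgesWidth c n + 2 * ε + k * (ω + 3 * ε)) ≤ p / 2 := by
      have h1 : 2 * ε + k * (ω + 3 * ε) ≤ q * (2 + 4 * (c * √(m : ℝ))) := by
        have : (k : ℝ) * (ω + 3 * ε) ≤ (c * √(m : ℝ)) * (4 * q) := by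
          refine mul_le_mul (by linarith) (by linarith) (by positivity) (by positivity)
        linarith
      have h2 : m * (q * (2 + 4 * (c * √(m : ℝ)))) = p / 4 := by
        rw [hq]; field_simp
      have h3 := mul_le_mul_of_nonneg_left h1 (by linarith : (0 : ℝ) ≤ m)
      rw [h2] at h3
      linarith
    have hmain := hT.sum_le_expectedComplexity hA
    have hsum : ENNReal.ofReal (k * (p / 2)) ≤ ∑ i ∈ Finset.range k,
        siteLaw m (occupiedEvent c m i ∩ goodEvent c n m k ω ε) := by
      have := Finset.card_nsmul_le_sum (Finset.range k)
        (fun i => siteLaw m (occupiedEvent c m i ∩ goodEvent c n m k ω ε))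
        (ENNReal.ofReal (p / 2)) fun i hi =>
          le_siteLaw_inter hc hm1 hfit hω hε.le hbad (Finset.mem_range.1 hi)
      rwa [Finset.card_range, nsmul_eq_mul, ← ENNReal.ofReal_natCast,
        ← ENNReal.ofReal_mul (Nat.cast_nonneg k)] at this
    have h4 : ENNReal.ofReal (n * (k * (p / 2))) ≤ expectedComplexity T m + n := by
      rw [ENNReal.ofReal_mul (Nat.cast_nonneg n), ENNReal.ofReal_natCast]
      exact (mul_le_mul_right hsum _).trans hmain
    have h5 : ENNReal.ofReal (n * (k * (p / 2)) - n) ≤ expectedComplexity T m := by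
      rw [ENNReal.ofReal_sub _ (Nat.cast_nonneg n), ENNReal.ofReal_natCast]
      exact tsub_le_iff_right.2 h4
    refine le_trans (ENNReal.ofReal_le_ofReal ?_) h5
    have h6 : 1 ≤ κ * p / 4 * √(m : ℝ) := by
      have h7 : (4 / (κ * p)) ^ 2 ≤ m :=
        (Nat.le_ceil _).trans (by exact_mod_cast (Nat.le_succ _).trans hm)
      have h8 : 4 / (κ * p) ≤ √(m : ℝ) := Real.le_sqrt_of_sq_le h7
      rw [div_le_iff₀ (by positivity)] at h8
      linarith
    have h9 : κ * p / 2 * √(m : ℝ) ≤ k * (p / 2) := by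
      have := mul_le_mul_of_nonneg_right hκk (by positivity : 0 ≤ p / 2)
      linarith
    have h10 : κ * p / 4 * √(m : ℝ) ≤ k * (p / 2) - 1 := by linarith
    have := mul_le_mul_of_nonneg_left h10 (by linarith : (0 : ℝ) ≤ n)
    linarith
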